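/- Let $(\mathcal C,\diamond,\mathbb 1,\gamma)$ be a braided monoidal category (associators and unitors are suppressed), write $\bar\gamma=\gamma^{-1}$ and $\mathrm{id}$ for identities, and let $H$ be an object of $\mathcal C$ with morphisms $\Delta:H\to H\diamond H$, $\epsilon:H\to\mathbb 1$, $m:H\diamond H\to H$, $\eta:\mathbb 1\to H$, $S,\bar S:H\to H$, $L:\mathbb 1\to H$, $l:H\to\mathbb 1$, $v,v^{-1}:H\to H$, $\sigma:\mathbb 1\to H\diamond H$. Consider the following relations. Bialgebra: (a1) $(\Delta\diamond\mathrm{id})\Delta=(\mathrm{id}\diamond\Delta)\Delta$; (a2-2') $(\epsilon\diamond\mathrm{id})\Delta=\mathrm{id}=(\mathrm{id}\diamond\epsilon)\Delta$; (a3) $m(m\diamond\mathrm{id})=m(\mathrm{id}\diamond m)$; (a4-4') $m(\mathrm{id}\diamond\eta)=\mathrm{id}=m(\eta\diamond\mathrm{id})$; (a5) $(m\diamond m)(\mathrm{id}\diamond\gamma\diamond\mathrm{id})(\Delta\diamond\Delta)=\Delta m$; (a6) $\epsilon m=\epsilon\diamond\epsilon$; (a7) $\Delta\eta=\eta\diamond\eta$;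 (a8) $\epsilon\eta=\mathrm{id}_{\mathbb 1}$. Antipode: (s1) $m(S\diamond\mathrm{id})\Delta=\eta\epsilon$; (s1') $m(\mathrm{id}\diamond S)\Delta=\eta\epsilon$; (s2-2') $S\bar S=\bar SS=\mathrm{id}$. Integrals: (i1) $(\mathrm{id}\diamond l)\Delta=\eta l$; (i2) $m(L\diamond\mathrm{id})=L\epsilon$; (i3) $lL=\mathrm{id}_{\mathbb 1}$; (i4) $SL=L$; (i5) $lS=l$. Ribbon: (r1-2) $vv^{-1}=v^{-1}v=\mathrm{id}$; (r3) $Sv=vS$; (r4) $\epsilon v=\epsilon$; (r5) $m(v\diamond\mathrm{id})=vm$; (r6) $\sigma=(v^{-1}\diamond v^{-1}S)\Delta v\eta$; (r7) $(\Delta\diamond\mathrm{id})\sigma=(\mathrm{id}\diamond\mathrm{id}\diamond m)(\mathrm{id}\diamond\sigma\diamond\mathrm{id})\sigma$; (r8) $\Delta v^{-1}=(v^{-1}\diamond v^{-1})\,\mu\,\bar\gamma\,\Delta$; (r9) $(m\diamond m)(S\diamond(\mu\bar\gamma\mu)\diamond S)(\rho_l\diamond\rho_r)=\gamma$, where $\mu=(m\diamond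 m)(\mathrm{id}\diamond\sigma\diamond\mathrm{id})$, $\rho_l=(\mathrm{id}\diamond m)(\sigma\diamond\mathrm{id})$, $\rho_r=(m\diamond\mathrm{id})(\mathrm{id}\diamond\sigma)$. Selfduality and normalization: (d) $(l\diamond\mathrm{id})\sigma=L$; (n) $lv\eta=\mathrm{id}_{\mathbb 1}$. Let $\alpha_0=\epsilon$, $\alpha_1=m(m\diamond S)(\mathrm{id}\diamond\gamma)(\Delta\diamond\mathrm{id}):H\diamond H\to H$ and $\alpha_{n+1}=(\alpha_n\diamond\alpha_1)(\mathrm{id}\diamond\gamma_{H,H^{\diamond n}}\diamond\mathrm{id})(\Delta\diamond\mathrm{id}):H\diamond H^{\diamond(n+1)}\to H^{\diamond(n+1)}$ for $n\ge1$ be the adjoint morphisms, and consider the relations (q) $\sigma\,\alpha_0=\alpha_2(\mathrm{id}\diamond\sigma)$ (the copairing intertwines with the adjoint action); (h10) $(\alpha_1\diamond\mathrm{id})(\mathrm{id}\diamond\gamma)(\Delta\diamond\mathrm{id})=\bar\gamma(\mathrm{id}\diamond\alpha_1)(\Delta\diamond\mathrm{id})$ as morphisms $H\diamond H\to H\diamond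 H$. The universal selfdual ribbon Hopf algebra $\bar{\bar{\mathcal H}}{}^r$ is the braided strict monoidal category freely generated by an object $H$ with morphisms as above subject to all the relations (a1)--(a8), (s1)--(s2'), (i1)--(i5), (r1)--(r9), (d), (n). **Proposition.** (a) In every braided monoidal category, if $H$ satisfies all the defining relations of $\bar{\bar{\mathcal H}}{}^r$ except possibly (r8), then (r8) holds if and only if (q) holds. (b) (Stamatova) In every braided monoidal category, if $H$ satisfies all the defining relations of $\bar{\bar{\mathcal H}}{}^r$ except possibly (r9), then (r9) holds if and only if (h10) holds. Therefore $\bar{\bar{\mathcal H}}{}^r$ is equivalent, as a braided monoidal category and by an equivalence that is the identity on objects and sends each diagram in the generators to the same diagram, to the braided strict monoidal category freely generated by an object $H$ with the same morphisms and relations, where (r8) and (r9) are replaced by (q) and (h10). -/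

import Mathlib

open CategoryTheory MonoidalCategory

universe v u

/-- A pair of parallel morphisms of `C`, read as the equation `lhs = rhs`. -/
structure Equation (C : Type u) [Category.{v} C] where
  {src : C}
  {tgt : C}
  lhs : src ⟶ tgt
  rhs : src ⟶ tgt

/-- The equation is true in `C`. -/
def Equation.Holds {C : Type u} [Category.{v} C] (e : Equation C) : Prop := e.lhs = e.rhs

/-- The elementary morphisms of a ribbon Hopf algebra on an object `H` of a braided monoidal
category, with no relation imposed on them. -/
structure HopfData {C : Type u} [Category.{v} C] [MonoidalCategory C] [BraidedCategory C]
    (H : C) where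
  /-- comultiplication -/
  Δ : H ⟶ H ⊗ H
  /-- counit -/
  ε : H ⟶ 𝟙_ C
  /-- multiplication -/
  m : H ⊗ H ⟶ H
  /-- unit -/
  η : 𝟙_ C ⟶ H
  /-- antipode -/
  S : H ⟶ H
  /-- inverse of the antipode -/
  Sinv : H ⟶ H
  /-- integral -/
  L : 𝟙_ C ⟶ H
  /-- cointegral -/
  l : H ⟶ 𝟙_ C
  /-- ribbon morphism -/
  v : H ⟶ H
  /-- inverse of the ribbon morphism -/
  vinv : H ⟶ H
  /-- copairing -/
  σ : 𝟙_ C ⟶ H ⊗ H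

/-- Names of the relations written out in `HopfData.eqn`. -/
inductive Ax : Type
  | a1 | a2 | a2' | a3 | a4 | a4' | a5 | a6 | a7 | a8
  | s1 | s1' | s2 | s2'
  | i1 | i2 | i3 | i4 | i5
  | r1 | r2 | r3 | r4 | r5 | r6 | r7 | r8 | r9
  | d | n
  | q | h10

namespace HopfData

variable {C : Type u} [Category.{v} C] [MonoidalCategory C] [BraidedCategory C] {H : C}

/-- The tensor powers of `H`: `𝟙`, `H`, `H ⊗ H`, `(H ⊗ H) ⊗ H`, and so on. -/
def pow (H : C) : ℕ → C
  | 0 => 𝟙_ C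
  | 1 => H
  | n + 2 => pow H (n + 1) ⊗ H

/-- The adjoint morphism `α₁ = m ∘ (m ⊗ S) ∘ (id ⊗ γ) ∘ (Δ ⊗ id)` of `H` on itself. -/
def adjOne (D : HopfData H) : H ⊗ H ⟶ H :=
  D.Δ ▷ H ≫ (α_ H H H).hom ≫ H ◁ (β_ H H).hom ≫ (α_ H H H).inv ≫ (D.m ⊗ₘ D.S) ≫ D.m

/-- The adjoint morphisms `αₙ : H ⊗ Hⁿ ⟶ Hⁿ`. Here `α₀` is the counit, and
`αₙ₊₁ = (αₙ ⊗ α₁) ∘ (id ⊗ γ_{H, Hⁿ} ⊗ id) ∘ (Δ ⊗ id)`, the middle map being `tensorμ`. -/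
def adj (D : HopfData H) : (n : ℕ) → (H ⊗ pow H n ⟶ pow H n)
  | 0 => (ρ_ H).hom ≫ D.ε
  | 1 => D.adjOne
  | n + 2 =>
    D.Δ ▷ (pow H (n + 1) ⊗ H) ≫ tensorμ H H (pow H (n + 1)) H ≫ (adj D (n + 1) ⊗ₘ D.adjOne)

/-- `μ = (m ⊗ m) ∘ (id ⊗ σ ⊗ id)`. -/
def mu (D : HopfData H) : H ⊗ H ⟶ H ⊗ H :=
  H ◁ (λ_ H).inv ≫ H ◁ D.σ ▷ H ≫ H ◁ (α_ H H H).hom ≫ (α_ H H (H ⊗ H)).inv ≫ (D.m ⊗ₘ D.m)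

/-- `ρ_l = (id ⊗ m) ∘ (σ ⊗ id)`. -/
def rhoL (D : HopfData H) : H ⟶ H ⊗ H :=
  (λ_ H).inv ≫ D.σ ▷ H ≫ (α_ H H H).hom ≫ H ◁ D.m

/-- `ρ_r = (m ⊗ id) ∘ (id ⊗ σ)`. -/
def rhoR (D : HopfData H) : H ⟶ H ⊗ H :=
  (ρ_ H).inv ≫ H ◁ D.σ ≫ (α_ H H H).inv ≫ D.m ▷ H

/-- The relations. Composition is written in diagrammatic order, `γ = (β_ H H).hom` and
`γ⁻¹ = (β_ H H).inv`. -/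
def eqn (D : HopfData H) : Ax → Equation C
  -- bialgebra
  | .a1 => ⟨D.Δ ≫ D.Δ ▷ H ≫ (α_ H H H).hom, D.Δ ≫ H ◁ D.Δ⟩
  | .a2 => ⟨D.Δ ≫ D.ε ▷ H ≫ (λ_ H).hom, 𝟙 H⟩
  | .a2' => ⟨D.Δ ≫ H ◁ D.ε ≫ (ρ_ H).hom, 𝟙 H⟩
  | .a3 => ⟨D.m ▷ H ≫ D.m, (α_ H H H).hom ≫ H ◁ D.m ≫ D.m⟩
  | .a4 => ⟨(ρ_ H).inv ≫ H ◁ D.η ≫ D.m, 𝟙 H⟩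
  | .a4' => ⟨(λ_ H).inv ≫ D.η ▷ H ≫ D.m, 𝟙 H⟩
  | .a5 => ⟨(D.Δ ⊗ₘ D.Δ) ≫ tensorμ H H H H ≫ (D.m ⊗ₘ D.m), D.m ≫ D.Δ⟩
  | .a6 => ⟨D.m ≫ D.ε, (D.ε ⊗ₘ D.ε) ≫ (λ_ (𝟙_ C)).hom⟩
  | .a7 => ⟨D.η ≫ D.Δ, (λ_ (𝟙_ C)).inv ≫ (D.η ⊗ₘ D.η)⟩
  | .a8 => ⟨D.η ≫ D.ε, 𝟙 (𝟙_ C)⟩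
  -- antipode
  | .s1 => ⟨D.Δ ≫ D.S ▷ H ≫ D.m, D.ε ≫ D.η⟩
  | .s1' => ⟨D.Δ ≫ H ◁ D.S ≫ D.m, D.ε ≫ D.η⟩
  | .s2 => ⟨D.Sinv ≫ D.S, 𝟙 H⟩
  | .s2' => ⟨D.S ≫ D.Sinv, 𝟙 H⟩
  -- integral and cointegral
  | .i1 => ⟨D.Δ ≫ H ◁ D.l ≫ (ρ_ H).hom, D.l ≫ D.η⟩
  | .i2 => ⟨(λ_ H).inv ≫ D.L ▷ H ≫ D.m, D.ε ≫ D.L⟩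
  | .i3 => ⟨D.L ≫ D.l, 𝟙 (𝟙_ C)⟩
  | .i4 => ⟨D.L ≫ D.S, D.L⟩
  | .i5 => ⟨D.S ≫ D.l, D.l⟩
  -- ribbon morphism and copairing
  | .r1 => ⟨D.v ≫ D.vinv, 𝟙 H⟩
  | .r2 => ⟨D.vinv ≫ D.v, 𝟙 H⟩
  | .r3 => ⟨D.v ≫ D.S, D.S ≫ D.v⟩
  | .r4 => ⟨D.v ≫ D.ε, D.ε⟩
  | .r5 => ⟨D.v ▷ H ≫ D.m, D.m ≫ D.v⟩
  | .r6 => ⟨D.σ, D.η ≫ D.v ≫ D.Δ ≫ (D.vinv ⊗ₘ (D.S ≫ D.vinv))⟩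
  | .r7 => ⟨D.σ ≫ D.Δ ▷ H ≫ (α_ H H H).hom,
      D.σ ≫ H ◁ (λ_ H).inv ≫ H ◁ D.σ ▷ H ≫ H ◁ (α_ H H H).hom ≫ H ◁ H ◁ D.m⟩
  | .r8 => ⟨D.vinv ≫ D.Δ, D.Δ ≫ (β_ H H).inv ≫ D.mu ≫ (D.vinv ⊗ₘ D.vinv)⟩
  | .r9 => ⟨(D.rhoL ⊗ₘ D.rhoR) ≫ (α_ H H (H ⊗ H)).hom ≫ H ◁ (α_ H H H).inv ≫
        (D.S ⊗ₘ ((D.mu ≫ (β_ H H).inv ≫ D.mu) ⊗ₘ D.S)) ≫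
        H ◁ (α_ H H H).hom ≫ (α_ H H (H ⊗ H)).inv ≫ (D.m ⊗ₘ D.m),
      (β_ H H).hom⟩
  -- selfduality and normalization
  | .d => ⟨D.σ ≫ D.l ▷ H ≫ (λ_ H).hom, D.L⟩
  | .n => ⟨D.η ≫ D.v ≫ D.l, 𝟙 (𝟙_ C)⟩
  -- the copairing `σ : H⁰ ⟶ H²` intertwines the adjoint morphisms: `σ ∘ α₀ = α₂ ∘ (id ⊗ σ)`
  | .q => ⟨(D.adj 0 ≫ D.σ : H ⊗ 𝟙_ C ⟶ H ⊗ H), (H ◁ D.σ ≫ D.adj 2 : H ⊗ 𝟙_ C ⟶ H ⊗ H)⟩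
  -- `(α₁ ⊗ id) ∘ (id ⊗ γ) ∘ (Δ ⊗ id) = γ⁻¹ ∘ (id ⊗ α₁) ∘ (Δ ⊗ id)`
  | .h10 => ⟨D.Δ ▷ H ≫ (α_ H H H).hom ≫ H ◁ (β_ H H).hom ≫ (α_ H H H).inv ≫ D.adjOne ▷ H,
      D.Δ ▷ H ≫ (α_ H H H).hom ≫ H ◁ D.adjOne ≫ (β_ H H).inv⟩

/-- The relation `a` is satisfied by the elementary morphisms `D`. -/
def Holds (D : HopfData H) (a : Ax) : Prop := (D.eqn a).Holds

end HopfData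

/-- The generators of the universal categories; the object `H ⊗ ⋯ ⊗ H` (`n` factors) is `n`. -/
inductive Gen : ℕ → ℕ → Type
  | Δ : Gen 1 2
  | ε : Gen 1 0
  | m : Gen 2 1
  | η : Gen 0 1
  | S : Gen 1 1
  | Sinv : Gen 1 1
  | L : Gen 0 1
  | l : Gen 1 0
  | v : Gen 1 1
  | vinv : Gen 1 1
  | σ : Gen 0 2

/-- Formal composites of products of generators, identities and braidings. The diagram `eq h`
is the identity of the object `m = n`. -/
inductive Diag : ℕ → ℕ → Type
  | gen {m n : ℕ} (g : Gen m n) : Diag m n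
  | eq {m n : ℕ} (h : m = n) : Diag m n
  | comp {m n p : ℕ} (f : Diag m n) (g : Diag n p) : Diag m p
  | tensor {m n p r : ℕ} (f : Diag m n) (g : Diag p r) : Diag (m + p) (n + r)
  | braid (m n : ℕ) : Diag (m + n) (n + m)
  | braidInv (m n : ℕ) : Diag (n + m) (m + n)

/-- The identity diagram. -/
abbrev Diag.id (m : ℕ) : Diag m m := .eq rfl

/-- A family of relations between parallel diagrams. -/
abbrev DiagRel : Type := ∀ ⦃m n : ℕ⦄, Diag m n → Diag m n → Prop

/-- The congruence generated by `R` and the axioms of a braided strict monoidal category. -/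
inductive Cong (R : DiagRel) : ∀ {m n : ℕ}, Diag m n → Diag m n → Prop
  | base {m n : ℕ} {f g : Diag m n} : R f g → Cong R f g
  | refl {m n : ℕ} (f : Diag m n) : Cong R f f
  | symm {m n : ℕ} {f g : Diag m n} : Cong R f g → Cong R g f
  | trans {m n : ℕ} {f g h : Diag m n} : Cong R f g → Cong R g h → Cong R f h
  | comp {m n p : ℕ} {f f' : Diag m n} {g g' : Diag n p} :
      Cong R f f' → Cong R g g' → Cong R (f.comp g) (f'.comp g')
  | tensor {m n p r : ℕ} {f f' : Diag m n} {g g' : Diag p r} :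
      Cong R f f' → Cong R g g' → Cong R (f.tensor g) (f'.tensor g')
  -- category
  | id_comp {m n : ℕ} (f : Diag m n) : Cong R ((Diag.id m).comp f) f
  | comp_id {m n : ℕ} (f : Diag m n) : Cong R (f.comp (Diag.id n)) f
  | assoc {m n p r : ℕ} (f : Diag m n) (g : Diag n p) (h : Diag p r) :
      Cong R ((f.comp g).comp h) (f.comp (g.comp h))
  -- strictly associative and unital product
  | tensor_id (m n : ℕ) : Cong R ((Diag.id m).tensor (Diag.id n)) (Diag.id (m + n))
  | tensor_comp {m n p m' n' p' : ℕ} (f : Diag m n) (g : Diag n p) (f' : Diag m' n')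
      (g' : Diag n' p') :
      Cong R ((f.tensor f').comp (g.tensor g')) ((f.comp g).tensor (f'.comp g'))
  | tensor_assoc {m n p m' n' p' : ℕ} (f : Diag m m') (g : Diag n n') (h : Diag p p') :
      Cong R (((f.tensor g).tensor h).comp (.eq (Nat.add_assoc m' n' p')))
        (Diag.comp (.eq (Nat.add_assoc m n p)) (f.tensor (g.tensor h)))
  | unit_tensor {m n : ℕ} (f : Diag m n) :
      Cong R (((Diag.id 0).tensor f).comp (.eq (Nat.zero_add n)))
        (Diag.comp (.eq (Nat.zero_add m)) f)
  | tensor_unit {m n : ℕ} (f : Diag m n) :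
      Cong R ((f.tensor (Diag.id 0)).comp (.eq (Nat.add_zero n)))
        (Diag.comp (.eq (Nat.add_zero m)) f)
  -- braiding
  | braid_inv (m n : ℕ) : Cong R ((Diag.braid m n).comp (.braidInv m n)) (Diag.id (m + n))
  | inv_braid (m n : ℕ) : Cong R ((Diag.braidInv m n).comp (.braid m n)) (Diag.id (n + m))
  | braid_nat {m n m' n' : ℕ} (f : Diag m m') (g : Diag n n') :
      Cong R ((f.tensor g).comp (.braid m' n')) (Diag.comp (.braid m n) (g.tensor f))
  | hexagon (m n p : ℕ) :
      Cong R
        (Diag.comp (.eq (Nat.add_assoc m n p)) (Diag.comp (.braid m (n + p))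
          (.eq (Nat.add_assoc n p m))))
        (Diag.comp ((Diag.braid m n).tensor (Diag.id p)) (Diag.comp (.eq (Nat.add_assoc n m p))
          ((Diag.id n).tensor (.braid m p))))
  | hexagon' (m n p : ℕ) :
      Cong R
        (Diag.comp (.eq (Nat.add_assoc m n p).symm) (Diag.comp (.braid (m + n) p)
          (.eq (Nat.add_assoc p m n).symm)))
        (Diag.comp ((Diag.id m).tensor (.braid n p)) (Diag.comp (.eq (Nat.add_assoc m p n).symm)
          ((Diag.braid m p).tensor (Diag.id n))))

/-- The braided strict monoidal category generated by an object `H`, the morphisms `Gen` and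
the relations `R`. Its objects are the powers of `H`. -/
@[ext]
structure Pres (R : DiagRel) where
  arity : ℕ

namespace Pres

variable {R : DiagRel}

/-- Diagrams up to the congruence. -/
def Hom (R : DiagRel) (m n : ℕ) : Type := Quot (Cong R (m := m) (n := n))

theorem sound {m n : ℕ} {f g : Diag m n} (h : Cong R f g) :
    (Quot.mk _ f : Hom R m n) = Quot.mk _ g := Quot.sound h

/-- Composition of classes. -/
def Hom.comp {m n p : ℕ} : Hom R m n → Hom R n p → Hom R m p :=
  Quot.map₂ Diag.comp (fun f _ _ h => .comp (.refl f) h) (fun _ _ g h => .comp h (.refl g))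

/-- Product of classes. -/
def Hom.tensor {m n p r : ℕ} : Hom R m n → Hom R p r → Hom R (m + p) (n + r) :=
  Quot.map₂ Diag.tensor (fun f _ _ h => .tensor (.refl f) h)
    (fun _ _ g h => .tensor h (.refl g))

instance : Category.{0} (Pres R) where
  Hom X Y := Hom R X.arity Y.arity
  id X := Quot.mk _ (Diag.id X.arity)
  comp f g := Hom.comp f g
  id_comp := by rintro _ _ ⟨f⟩; exact sound (.id_comp f)
  comp_id := by rintro _ _ ⟨f⟩; exact sound (.comp_id f)
  assoc := by rintro _ _ _ _ ⟨f⟩ ⟨g⟩ ⟨h⟩; exact sound (.assoc f g h)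

/-- The morphism represented by a diagram. -/
def ofDiag (R : DiagRel) {m n : ℕ} (f : Diag m n) : (⟨m⟩ : Pres R) ⟶ ⟨n⟩ := Quot.mk _ f

theorem eq_comp_eq {m n p : ℕ} (h : m = n) (k : n = p) :
    Cong R ((Diag.eq h).comp (.eq k)) (.eq (h.trans k)) := by
  subst h k; exact .id_comp _

theorem eq_tensor_eq {m n p r : ℕ} (h : m = n) (k : p = r) :
    Cong R ((Diag.eq h).tensor (.eq k)) (.eq (congrArg₂ (· + ·) h k)) := by
  subst h k; exact .tensor_id _ _

/-- The identity, seen as an isomorphism between equal objects. -/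
def eqIso {m n : ℕ} (h : m = n) : (⟨m⟩ : Pres R) ≅ ⟨n⟩ where
  hom := ofDiag R (.eq h)
  inv := ofDiag R (.eq h.symm)
  hom_inv_id := sound (eq_comp_eq h h.symm)
  inv_hom_id := sound (eq_comp_eq h.symm h)

instance : MonoidalCategoryStruct (Pres R) where
  tensorObj X Y := ⟨X.arity + Y.arity⟩
  tensorUnit := ⟨0⟩
  tensorHom f g := Hom.tensor f g
  whiskerLeft X _ _ f := Hom.tensor (Quot.mk _ (Diag.id X.arity)) f
  whiskerRight f Y := Hom.tensor f (Quot.mk _ (Diag.id Y.arity))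
  associator X Y Z := eqIso (Nat.add_assoc X.arity Y.arity Z.arity)
  leftUnitor X := eqIso (Nat.zero_add X.arity)
  rightUnitor X := eqIso (Nat.add_zero X.arity)

instance : MonoidalCategory (Pres R) :=
  MonoidalCategory.ofTensorHom
    (id_tensorHom_id := fun _ _ => sound (.tensor_id _ _))
    (id_tensorHom := fun _ _ _ _ => rfl)
    (tensorHom_id := fun _ _ => rfl)
    (tensorHom_comp_tensorHom := by
      rintro _ _ _ _ _ _ ⟨f⟩ ⟨f'⟩ ⟨g⟩ ⟨g'⟩; exact sound (.tensor_comp f g f' g'))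
    (associator_naturality := by
      rintro _ _ _ _ _ _ ⟨f⟩ ⟨g⟩ ⟨h⟩; exact sound (.tensor_assoc f g h))
    (leftUnitor_naturality := by rintro _ _ ⟨f⟩; exact sound (.unit_tensor f))
    (rightUnitor_naturality := by rintro _ _ ⟨f⟩; exact sound (.tensor_unit f))
    (pentagon := fun _ _ _ _ => sound
      (.trans (.comp (eq_tensor_eq _ rfl)
        (.trans (.comp (.refl _) (eq_tensor_eq rfl _)) (eq_comp_eq _ _)))
        (.trans (eq_comp_eq _ _) (.symm (eq_comp_eq _ _)))))
    (triangle := fun _ _ => sound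
      (.trans (.comp (.refl _) (eq_tensor_eq rfl _))
        (.trans (eq_comp_eq _ _) (.symm (eq_tensor_eq _ rfl)))))

instance : BraidedCategory (Pres R) where
  braiding X Y :=
    { hom := ofDiag R (.braid X.arity Y.arity)
      inv := ofDiag R (.braidInv X.arity Y.arity)
      hom_inv_id := sound (.braid_inv _ _)
      inv_hom_id := sound (.inv_braid _ _) }
  braiding_naturality_right := by rintro X _ _ ⟨f⟩; exact sound (.braid_nat _ f)
  braiding_naturality_left := by rintro _ _ ⟨f⟩ Z; exact sound (.braid_nat f _)
  hexagon_forward _ _ _ := sound (.hexagon _ _ _)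
  hexagon_reverse _ _ _ := sound (.hexagon' _ _ _)

/-- The generating object `H`. -/
abbrev gen (R : DiagRel) : Pres R := ⟨1⟩

/-- The generating morphisms. -/
def genData (R : DiagRel) : HopfData (gen R) where
  Δ := ofDiag R (.gen .Δ)
  ε := ofDiag R (.gen .ε)
  m := ofDiag R (.gen .m)
  η := ofDiag R (.gen .η)
  S := ofDiag R (.gen .S)
  Sinv := ofDiag R (.gen .Sinv)
  L := ofDiag R (.gen .L)
  l := ofDiag R (.gen .l)
  v := ofDiag R (.gen .v)
  vinv := ofDiag R (.gen .vinv)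
  σ := ofDiag R (.gen .σ)

end Pres

/-- No relation beyond those of a braided strict monoidal category. -/
def noRel : DiagRel := fun _ _ _ _ => False

/-- The relations named in `A`, as relations between diagrams: each equation is written with the
generators in the free braided strict monoidal category, and its two sides are then represented
by diagrams. -/
def axRel (A : Set Ax) : DiagRel := fun _ _ f g =>
  ∃ a ∈ A, (Pres.genData noRel).eqn a = (⟨Pres.ofDiag noRel f, Pres.ofDiag noRel g⟩ : Equation _)

/-- The braided strict monoidal category freely generated by an object with the elementary
morphisms of a ribbon Hopf algebra, subject to the relations named in `A`. -/
abbrev UnivCat (A : Set Ax) : Type := Pres (axRel A)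

/-- The generators of the universal category satisfy the relations named in `A`. -/
theorem UnivCat.genData_holds (A : Set Ax) {a : Ax} (ha : a ∈ A) :
    (Pres.genData (axRel A)).Holds a := by
  cases a <;> exact Pres.sound (.base ⟨_, ha, rfl⟩)

/-- The axioms of the universal selfdual ribbon Hopf algebra. -/
def selfdualAxioms : Set Ax := {a | a ≠ .q ∧ a ≠ .h10}

/-- The same axioms with `r8` and `r9` replaced by `q` and `h10`. -/
def alternativeAxioms : Set Ax := {a | a ≠ .r8 ∧ a ≠ .r9}

/-! Call core relations those other than (r8), (r9), (q), (h10). They imply both (q) and (r8), and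
they make (r9) and (h10) equivalent to one and the same third relation. Hence the two lists of
relations generate the same congruence on diagrams, and the universal categories agree.

(q): by (r5) and its mirror image, `v` is multiplication by the central element vη, and (r6) amounts
to Δ(vη) = (v ⊗ vS⁻¹)σ. Centrality makes (id ⊗ S⁻¹)σ commute with every Δ(x) in the braided algebra
H ⊗ H. Moving the antipodes around turns this into the adjoint invariance of σ (`sigma_ad`).

(r8): in the same algebra (id ⊗ S⁻¹)σ · σ = 1, which gives Δ(v⁻¹η) = (v⁻¹ ⊗ v⁻¹)σ, hence Δv⁻¹(x) =
(v⁻¹ ⊗ v⁻¹)(Δ(x) · σ). It remains to identify the braided product Δ(x) · σ with μγ⁻¹Δ(x)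
(`comul_sigma`). Here the integrals enter: (d) makes σ nondegenerate, so lv is cocentral, and
evaluating lv on either side of Δ(xσ₁) yields the identity.

(r9) ⇔ (h10): the pivot says that γ² is the simultaneous adjoint action of the two legs of σ, on the
right of the first factor and on the left of the second. Preceded by γ⁻¹, this action is the left
side of (r9) (`conj_ad_eq`). It also relates (id ⊗ α₁)Δ to (id ⊗ α₁)γ⁻¹Δ (`comul_ad`), and the
latter is a split epimorphism (`comul_ad_inv`), so it can be cancelled.

Diagrammatic identities are proved by reflection: diagrams become words of layers, a proof becomes a
list of rewriting steps, and the kernel runs a checker proved sound once (`Eqv.of_steps`). -/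

/-! ### String diagrams as words of layers -/

/-- The elementary diagrams of the graphical calculus. -/
inductive Cell : Type
  | Δ | ε | m | η | S | Sinv | L | l | v | vinv | σ
  /-- the braiding -/
  | γ
  /-- the inverse braiding -/
  | γi
  /-- the adjoint morphism `α₁` -/
  | ad

namespace Cell

/-- The number of strands entering an elementary diagram. -/
def dom : Cell → ℕ
  | Δ => 1 | ε => 1 | m => 2 | η => 0 | S => 1 | Sinv => 1 | L => 0 | l => 1 | v => 1 | vinv => 1
  | σ => 0 | γ => 2 | γi => 2 | ad => 2

/-- The number of strands leaving an elementary diagram. -/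
def cod : Cell → ℕ
  | Δ => 2 | ε => 0 | m => 1 | η => 1 | S => 1 | Sinv => 1 | L => 1 | l => 0 | v => 1 | vinv => 1
  | σ => 2 | γ => 2 | γi => 2 | ad => 1

/-- A numbering of the elementary diagrams. -/
def code : Cell → ℕ
  | Δ => 0 | ε => 1 | m => 2 | η => 3 | S => 4 | Sinv => 5 | L => 6 | l => 7 | v => 8 | vinv => 9
  | σ => 10 | γ => 11 | γi => 12 | ad => 13

theorem code_injective : Function.Injective code := by
  intro a b h
  cases a <;> cases b <;> first | rfl | exact absurd h (by decide)

end Cell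

/-- A word is a list of elementary diagrams, from top to bottom, each with the number of strands
that pass on its left. -/
abbrev Word : Type := List (ℕ × Cell)

namespace Word

/-- Equality of layers, as a Boolean. -/
def layerEq (a b : ℕ × Cell) : Bool := a.1.beq b.1 && a.2.code.beq b.2.code

theorem eq_of_layerEq {a b : ℕ × Cell} (h : layerEq a b = true) : a = b := by
  simp only [layerEq, Bool.and_eq_true, Nat.beq_eq] at h
  exact Prod.ext h.1 (Cell.code_injective h.2)

/-- The number of strands leaving a word with `n` strands entering it, if it is well-formed. -/
def width : Word → ℕ → Option ℕ
  | [], n => some n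
  | (i, g) :: w, n => if (i + g.dom).ble n then width w (n - g.dom + g.cod) else none

/-- Interchange of two consecutive layers. -/
def swap (a b : ℕ × Cell) : Option ((ℕ × Cell) × (ℕ × Cell)) :=
  if (a.1 + a.2.cod).ble b.1 then some ((b.1 - a.2.cod + a.2.dom, b.2), a)
  else if (b.1 + b.2.dom).ble a.1 then some (b, (a.1 - b.2.dom + b.2.cod, a.2))
  else none

/-- Move a layer from the bottom of a word to its top. -/
def moveUp : Word → ℕ × Cell → Option ((ℕ × Cell) × Word)
  | [], b => some (b, [])
  | a :: w, b => (moveUp w b).bind fun p => (swap a p.1).map fun s => (s.1, s.2 :: p.2)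

/-- Two layers `a` and `b` on disjoint sets of strands, as they are after the other one. -/
def par (a b : ℕ × Cell) : Option ((ℕ × Cell) × (ℕ × Cell)) :=
  if (a.1 + a.2.dom).ble b.1 then some (a, (b.1 - a.2.dom + a.2.cod, b.2))
  else if (b.1 + b.2.dom).ble a.1 then some ((a.1 - b.2.dom + b.2.cod, a.2), b)
  else none

/-- Find the layer `a` at the top of a word, up to interchange, and remove it. -/
def extract : Word → ℕ × Cell → Option Word
  | [], _ => none
  | b :: w, a =>
    if layerEq a b then some w
    else (par a b).bind fun s => (extract w s.1).map fun t => s.2 :: t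

/-- Equality up to interchange. -/
def planarEq (w : Word) : Word → Bool
  | [] => w.isEmpty
  | a :: w' => match extract w a with
    | none => false
    | some t => planarEq t w'

/-- Add `i` strands on the left. -/
def shift (i : ℕ) (w : Word) : Word := w.map fun a => (i + a.1, a.2)

/-- Priorities of the elementary diagrams in normal forms. -/
def _root_.Cell.rank : Cell → ℕ
  | .ε | .l => 0
  | .η | .L | .σ => 1
  | _ => 2

/-- Bring a layer of lowest rank, and leftmost for this rank, to the top of the word `b :: (v ++ w)`. -/
def pick : ℕ × Cell → (v w : Word) → (ℕ × Cell) × Word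
  | b, v, [] => (b, v)
  | b, v, a :: w => match moveUp v a with
    | none => pick b (v ++ [a]) w
    | some (c, v') => match swap b c with
      | none => pick b (v ++ [a]) w
      | some (c', b') =>
        if c'.2.rank.blt b.2.rank || c'.2.rank.beq b.2.rank &&
            (c'.1.blt b.1 || c'.1.beq b.1 && c.1.ble b.1) then pick c' (b' :: v') w else pick b (v ++ [a]) w

/-- The normal form of a word with at most `n` layers, up to interchange. -/
def canon : ℕ → Word → Word
  | 0, w => w
  | _ + 1, [] => []
  | n + 1, a :: w => (pick a [] w).1 :: canon n (pick a [] w).2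

/-- The normal form of a word up to interchange. -/
def normal (w : Word) : Word := canon w.length w

/-- Find a word up to interchange at the top of `rest`, starting at the offset `i`. The result is
a word which is found, together with what precedes it and what follows it. -/
def find : (rest remaining before found after : Word) → ℕ → Word × Word × Word × ℕ
  | [], _, u, f, v, i => (u, f, v, i)
  | a :: w, q, u, f, v, i =>
    if q.isEmpty then (u, f, v ++ a :: w, i)
    else match moveUp v a with
      | none => find w q u f (v ++ [a]) i
      | some (a', v') => match extract q a' with
        | some q' => find w q' u (f ++ [a']) v' i
        | none => match moveUp f a' with
          | none => find w q u f (v ++ [a]) i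
          | some (a'', f') =>
            -- The layer goes above what has been found. If the latter keeps its offsets, so does
            -- the rest of the pattern; otherwise the layer is taken to lie on the left. A wrong
            -- guess can only make the search fail.
            if planarEq f f' then find w q (u ++ [a'']) f' v' i
            else find w (q.map fun b => (b.1 + a''.2.cod - a''.2.dom, b.2)) (u ++ [a'']) f' v'
              (i + a''.2.cod - a''.2.dom)

/-- Bring the layers of `w` that are selected by the binary digits of `s` to its top, where `u`
and `v` are the layers that have been selected, and rejected, so far. -/
def select : (s : ℕ) → (w u v : Word) → Word
  | _, [], u, v => u ++ v
  | s, a :: w, u, v =>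
    if (s % 2).beq 1 then
      match moveUp v a with
      | none => u ++ (v ++ a :: w)
      | some (b, v') => select (s / 2) w (u ++ [b]) v'
    else select (s / 2) w u (v ++ [a])

/-- Replace the word `l` by `r` at the height `k` and the offset `i` of a word with `n` strands
entering it, where `l` and `r` have `m` strands entering them. -/
def rewrite (m : ℕ) (l r : Word) (k i n : ℕ) (w : Word) : Option Word :=
  let p := find (w.drop k) (shift i l) [] [] [] i
  (width (w.take k ++ p.1) n).bind fun q =>
    -- This test, and not the search, guarantees that the pattern really occurs and has enough
    -- strands.
    if (m + p.2.2.2).ble q && planarEq p.2.1 (shift p.2.2.2 l) then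
      some (w.take k ++ (p.1 ++ (shift p.2.2.2 r ++ p.2.2.1)))
    else none

end Word

/-! ### Values of words in a braided monoidal category -/

section Evaluation

variable {C : Type u} [Category.{v} C] [MonoidalCategory C]

/-- The tensor powers of `H`, bracketed to the right. -/
def strands (H : C) : ℕ → C
  | 0 => 𝟙_ C
  | n + 1 => H ⊗ strands H n

/-- Morphisms out of a power of `H` into some power of `H`. -/
abbrev Out (H : C) (n : ℕ) : Type v := Σ p : ℕ, strands H n ⟶ strands H p

variable {H : C}

/-- Add a strand on the left. -/
def Out.lift {n : ℕ} (f : Out H n) : Out H (n + 1) := ⟨f.1 + 1, H ◁ f.2⟩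

variable [BraidedCategory C]

namespace HopfData

/-- The value of an elementary diagram acting on the leftmost strands. -/
def cell (D : HopfData H) : Cell → (n : ℕ) → Out H n
  | .Δ, n + 1 => ⟨n + 2, D.Δ ▷ strands H n ≫ (α_ H H (strands H n)).hom⟩
  | .ε, n + 1 => ⟨n, D.ε ▷ strands H n ≫ (λ_ (strands H n)).hom⟩
  | .m, n + 2 => ⟨n + 1, (α_ H H (strands H n)).inv ≫ D.m ▷ strands H n⟩
  | .η, n => ⟨n + 1, (λ_ (strands H n)).inv ≫ D.η ▷ strands H n⟩
  | .S, n + 1 => ⟨n + 1, D.S ▷ strands H n⟩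
  | .Sinv, n + 1 => ⟨n + 1, D.Sinv ▷ strands H n⟩
  | .L, n => ⟨n + 1, (λ_ (strands H n)).inv ≫ D.L ▷ strands H n⟩
  | .l, n + 1 => ⟨n, D.l ▷ strands H n ≫ (λ_ (strands H n)).hom⟩
  | .v, n + 1 => ⟨n + 1, D.v ▷ strands H n⟩
  | .vinv, n + 1 => ⟨n + 1, D.vinv ▷ strands H n⟩
  | .σ, n => ⟨n + 2, (λ_ (strands H n)).inv ≫ D.σ ▷ strands H n ≫ (α_ H H (strands H n)).hom⟩
  | .γ, n + 2 => ⟨n + 2, (α_ H H (strands H n)).inv ≫ (β_ H H).hom ▷ strands H n ≫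
      (α_ H H (strands H n)).hom⟩
  | .γi, n + 2 => ⟨n + 2, (α_ H H (strands H n)).inv ≫ (β_ H H).inv ▷ strands H n ≫
      (α_ H H (strands H n)).hom⟩
  | .ad, n + 2 => ⟨n + 1, (α_ H H (strands H n)).inv ≫ D.adjOne ▷ strands H n⟩
  -- Default value when too few strands enter; `Word.width` rules this case out.
  | _, n => ⟨n, 𝟙 _⟩

/-- The value of a layer. -/
def layer (D : HopfData H) (g : Cell) : ℕ → (n : ℕ) → Out H n
  | 0, n => D.cell g n
  | i + 1, n + 1 => (layer D g i n).lift
  | _ + 1, 0 => ⟨0, 𝟙 _⟩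

/-- The value of a word. -/
def eval (D : HopfData H) : Word → (n : ℕ) → Out H n
  | [], n => ⟨n, 𝟙 _⟩
  | a :: w, n => ⟨(eval D w (D.layer a.2 a.1 n).1).1,
      (D.layer a.2 a.1 n).2 ≫ (eval D w (D.layer a.2 a.1 n).1).2⟩

end HopfData
end Evaluation

/-! ### The interchange law and the congruence of words -/

section Soundness

variable {C : Type u} [Category.{v} C] [MonoidalCategory C] {H : C}

/-- Composition. -/
def Out.bind {n : ℕ} (f : Out H n) (g : (p : ℕ) → Out H p) : Out H n :=
  ⟨(g f.1).1, f.2 ≫ (g f.1).2⟩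

theorem Out.bind_assoc {n : ℕ} (f : Out H n) (g h : (p : ℕ) → Out H p) :
    (f.bind g).bind h = f.bind fun p => (g p).bind h := by
  simp [Out.bind]

theorem Out.bind_congr {n : ℕ} (f : Out H n) {g h : (p : ℕ) → Out H p} (e : g f.1 = h f.1) :
    f.bind g = f.bind h := by
  unfold Out.bind; rw [e]

theorem Out.lift_bind {n : ℕ} (f : Out H n) {g h : (p : ℕ) → Out H p}
    (e : ∀ p, h (p + 1) = (g p).lift) : (f.bind g).lift = f.lift.bind h := by
  have := e f.1
  simp only [Out.bind, Out.lift] at this ⊢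
  rw [this, whiskerLeft_comp]
  rfl

variable [BraidedCategory C] (D : HopfData H)

namespace HopfData

theorem cell_fst (g : Cell) (n : ℕ) : (D.cell g (n + g.dom)).1 = n + g.cod := by
  cases g <;> rfl

theorem layer_fst (g : Cell) (i n : ℕ) :
    (D.layer g i (n + (i + g.dom))).1 = n + (i + g.cod) := by
  induction i with
  | zero => rw [Nat.zero_add, Nat.zero_add]; exact D.cell_fst g n
  | succ i ih =>
    have h : n + (i + 1 + g.dom) = n + (i + g.dom) + 1 := by ring
    rw [h]
    change (D.layer g i (n + (i + g.dom))).1 + 1 = _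
    rw [ih]; ring

theorem eval_cons (a : ℕ × Cell) (w : Word) (n : ℕ) :
    D.eval (a :: w) n = (D.layer a.2 a.1 n).bind (D.eval w) := rfl

theorem eval_nil_bind {n : ℕ} (g : (p : ℕ) → Out H p) : (D.eval [] n).bind g = g n := by
  simp [eval, Out.bind]

theorem eval_append (w w' : Word) (n : ℕ) :
    D.eval (w ++ w') n = (D.eval w n).bind (D.eval w') := by
  induction w generalizing n with
  | nil => rw [eval_nil_bind]; rfl
  | cons a w ih =>
    rw [List.cons_append, eval_cons, eval_cons, Out.bind_assoc]
    exact Out.bind_congr _ (ih _)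

theorem eval_shift_one (w : Word) (n : ℕ) :
    D.eval (Word.shift 1 w) (n + 1) = (D.eval w n).lift := by
  induction w generalizing n with
  | nil => simp [Word.shift, eval, Out.lift]; rfl
  | cons a w ih =>
    rw [eval_cons, Out.lift_bind (h := D.eval (Word.shift 1 w)) _ (fun p => ih p)]
    obtain ⟨i, g⟩ := a
    simp only [Word.shift, List.map_cons, eval_cons, Nat.add_comm 1 i]
    rfl

/-- Interchange is bifunctoriality of the product: with the first cell at the left edge, the other
layer is an arbitrary morphism of the remaining strands, and whisker exchange applies. -/
theorem eval_swap_zero (g g' : Cell) (k n : ℕ) :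
    (D.cell g (n + g.dom)).bind (D.layer g' (k + g.cod)) =
      (D.layer g' (k + g.dom) (n + g.dom)).bind (D.cell g) := by
  cases g <;>
  · simp only [Cell.dom, Cell.cod, Out.bind, layer, cell, Out.lift, Nat.add_zero]
    generalize D.layer g' k n = F
    obtain ⟨p, f⟩ := F
    refine Sigma.ext rfl (heq_of_eq ?_)
    dsimp only [strands]
    simp only [Category.assoc, associator_inv_naturality_right_assoc,
      leftUnitor_inv_naturality_assoc, whisker_exchange, whisker_exchange_assoc,
      associator_naturality_right, leftUnitor_naturality]

theorem eval_swap (g g' : Cell) (i k n : ℕ) :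
    D.eval [(i, g), (k + (i + g.cod), g')] (n + (i + g.dom)) =
      D.eval [(k + (i + g.dom), g'), (i, g)] (n + (i + g.dom)) := by
  induction i with
  | zero =>
    have h (g : Cell) (i : ℕ) (p : ℕ) : D.eval [(i, g)] p = D.layer g i p := by
      simp [eval]
    rw [eval_cons, eval_cons, funext (h _ _), funext (h _ _)]
    rw [Nat.zero_add, Nat.zero_add]
    exact D.eval_swap_zero g g' k n
  | succ i ih =>
    have := congrArg Out.lift ih
    rw [← eval_shift_one, ← eval_shift_one] at this
    simp only [Word.shift, List.map_cons, List.map_nil] at this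
    rw [show n + (i + 1 + g.dom) = n + (i + g.dom) + 1 by ring,
      show k + (i + 1 + g.cod) = 1 + (k + (i + g.cod)) by ring,
      show k + (i + 1 + g.dom) = 1 + (k + (i + g.dom)) by ring, Nat.add_comm i 1]
    exact this

end HopfData

namespace Word

theorem width_append (w w' : Word) (n : ℕ) :
    width (w ++ w') n = (width w n).bind (width w') := by
  induction w generalizing n with
  | nil => rfl
  | cons a w ih => simp only [List.cons_append, width]; split <;> simp [ih]

theorem width_add {w : Word} {n p : ℕ} (h : width w n = some p) (j : ℕ) :
    width w (j + n) = some (j + p) := by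
  induction w generalizing n with
  | nil => simp_all [width]
  | cons a w ih =>
    simp only [width, Nat.ble_eq, Option.ite_none_right_eq_some] at h ⊢
    refine ⟨by omega, ?_⟩
    rw [show j + n - a.2.dom + a.2.cod = j + (n - a.2.dom + a.2.cod) by omega]
    exact ih h.2

theorem width_shift {w : Word} {n p : ℕ} (h : width w n = some p) (i : ℕ) :
    width (shift i w) (n + i) = some (p + i) := by
  induction w generalizing n with
  | nil => simp_all [width, shift]
  | cons a w ih =>
    simp only [shift, List.map_cons, width, Nat.ble_eq, Option.ite_none_right_eq_some] at h ⊢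
    refine ⟨by omega, ?_⟩
    rw [show n + i - a.2.dom + a.2.cod = n - a.2.dom + a.2.cod + i by omega]
    exact ih h.2

theorem shift_add (i j : ℕ) (w : Word) : shift (i + j) w = shift i (shift j w) := by
  simp [shift, Nat.add_assoc]

end Word

namespace HopfData

theorem eval_fst {w : Word} {n p : ℕ} (h : Word.width w n = some p) : (D.eval w n).1 = p := by
  induction w generalizing n with
  | nil => simp_all [Word.width, eval]
  | cons a w ih =>
    simp only [Word.width, Nat.ble_eq, Option.ite_none_right_eq_some] at h
    obtain ⟨j, rfl⟩ := Nat.exists_eq_add_of_le h.1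
    rw [Nat.add_comm _ j] at h ⊢
    rw [show j + (a.1 + a.2.dom) - a.2.dom + a.2.cod = j + (a.1 + a.2.cod) by omega,
      ← D.layer_fst] at h
    exact ih h.2

/-- Two words with `n` strands entering them are well-formed, and they have the same value
whatever is on their right. -/
structure Eqv (n : ℕ) (w w' : Word) : Prop where
  width_eq : Word.width w n = Word.width w' n
  wf : (Word.width w' n).isSome = true
  eval_eq : ∀ j, D.eval w (j + n) = D.eval w' (j + n)

variable {D}

namespace Eqv

theorem wf' {n : ℕ} {w w' : Word} (h : D.Eqv n w w') : (Word.width w n).isSome = true :=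
  h.width_eq ▸ h.wf

theorem refl {n : ℕ} {w : Word} (h : (Word.width w n).isSome = true) : D.Eqv n w w :=
  ⟨rfl, h, fun _ => rfl⟩

theorem symm {n : ℕ} {w w' : Word} (h : D.Eqv n w w') : D.Eqv n w' w :=
  ⟨h.width_eq.symm, h.wf', fun j => (h.eval_eq j).symm⟩

theorem trans {n : ℕ} {w w' w'' : Word} (h : D.Eqv n w w') (h' : D.Eqv n w' w'') :
    D.Eqv n w w'' :=
  ⟨h.width_eq.trans h'.width_eq, h'.wf, fun j => (h.eval_eq j).trans (h'.eval_eq j)⟩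

theorem append {n p : ℕ} {a a' b b' : Word} (h : D.Eqv n a a') (hp : Word.width a n = some p)
    (h' : D.Eqv p b b') : D.Eqv n (a ++ b) (a' ++ b') := by
  have hp' : Word.width a' n = some p := h.width_eq ▸ hp
  refine ⟨?_, ?_, fun j => ?_⟩
  · simp [Word.width_append, hp, hp', h'.width_eq]
  · simpa [Word.width_append, hp'] using h'.wf
  · rw [eval_append, eval_append, h.eval_eq]
    refine Out.bind_congr _ ?_
    rw [D.eval_fst (Word.width_add hp' j)]
    exact h'.eval_eq j

theorem append_left {n p : ℕ} {b b' : Word} (a : Word) (hp : Word.width a n = some p)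
    (h' : D.Eqv p b b') : D.Eqv n (a ++ b) (a ++ b') :=
  append (refl (by simp [hp])) hp h'

theorem append_right {n : ℕ} {a a' : Word} (h : D.Eqv n a a') (b : Word)
    (hb : (Word.width (a ++ b) n).isSome = true) : D.Eqv n (a ++ b) (a' ++ b) := by
  obtain ⟨p, hp⟩ := Option.isSome_iff_exists.1 h.wf'
  refine append h hp (refl ?_)
  simpa [Word.width_append, hp] using hb

theorem shift_one {n : ℕ} {w w' : Word} (h : D.Eqv n w w') :
    D.Eqv (n + 1) (Word.shift 1 w) (Word.shift 1 w') := by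
  obtain ⟨p, hp⟩ := Option.isSome_iff_exists.1 h.wf
  refine ⟨?_, ?_, fun j => ?_⟩
  · rw [Word.width_shift hp, Word.width_shift (h.width_eq.trans hp)]
  · rw [Word.width_shift hp]; rfl
  · rw [← Nat.add_assoc, eval_shift_one, eval_shift_one, h.eval_eq]

theorem shift {n : ℕ} {w w' : Word} (h : D.Eqv n w w') (i : ℕ) :
    D.Eqv (n + i) (Word.shift i w) (Word.shift i w') := by
  induction i with
  | zero => simpa [Word.shift] using h
  | succ i ih =>
    rw [Nat.add_comm i 1, Word.shift_add, Word.shift_add, Nat.add_comm 1 i, ← Nat.add_assoc]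
    exact ih.shift_one

theorem add {n : ℕ} {w w' : Word} (h : D.Eqv n w w') (k : ℕ) : D.Eqv (k + n) w w' := by
  obtain ⟨p, hp⟩ := Option.isSome_iff_exists.1 h.wf
  refine ⟨?_, ?_, fun j => ?_⟩
  · rw [Word.width_add hp, Word.width_add (h.width_eq.trans hp)]
  · rw [Word.width_add hp]; rfl
  · rw [← Nat.add_assoc, h.eval_eq]

theorem shift_of_le {n i p : ℕ} {w w' : Word} (h : D.Eqv n w w') (hp : n + i ≤ p) :
    D.Eqv p (Word.shift i w) (Word.shift i w') := by
  obtain ⟨k, rfl⟩ := Nat.exists_eq_add_of_le hp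
  rw [Nat.add_comm]
  exact (h.shift i).add k

end Eqv
end HopfData
end Soundness

/-! ### A verified rewriting procedure modulo interchange -/

section Checker

variable {C : Type u} [Category.{v} C] [MonoidalCategory C] [BraidedCategory C] {H : C}
  {D : HopfData H}

namespace HopfData.Eqv

open Word

theorem interchange {g g' : Cell} {i k n : ℕ} (h : i + g.dom ≤ k) (hn : k + g'.dom ≤ n) :
    D.Eqv n [(i, g), (k - g.dom + g.cod, g')] [(k, g'), (i, g)] := by
  obtain ⟨k, rfl⟩ := Nat.exists_eq_add_of_le h
  obtain ⟨n, rfl⟩ := Nat.exists_eq_add_of_le hn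
  refine ⟨?_, ?_, fun j => ?_⟩
  · simp only [width, Nat.ble_eq]
    repeat' split
    all_goals first | (congr 1; omega) | omega
  · simp only [width, Nat.ble_eq]
    repeat' split
    all_goals first | rfl | omega
  · have := D.eval_swap g g' i k (j + n + k + g'.dom)
    rwa [show j + n + k + g'.dom + (i + g.dom) = j + (i + g.dom + k + g'.dom + n) by ring,
      show k + (i + g.cod) = i + g.dom + k - g.dom + g.cod by omega,
      Nat.add_comm k (i + g.dom)] at this

theorem swap_sound {a b : ℕ × Cell} {s : (ℕ × Cell) × (ℕ × Cell)} {n : ℕ}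
    (hs : swap a b = some s) (h : (width [a, b] n).isSome = true) :
    D.Eqv n [a, b] [s.1, s.2] := by
  obtain ⟨i, g⟩ := a
  obtain ⟨k, g'⟩ := b
  have hw : i + g.dom ≤ n ∧ k + g'.dom ≤ n - g.dom + g.cod := by
    simp only [width, Nat.ble_eq] at h
    constructor <;> · by_contra hc; simp [hc] at h
  simp only [swap, Nat.ble_eq] at hs
  split at hs
  next h1 =>
    obtain rfl := Option.some.inj hs
    have := interchange (D := D) (g := g) (g' := g') (i := i) (k := k - g.cod + g.dom) (n := n)
      (by omega) (by omega)
    rwa [show k - g.cod + g.dom - g.dom + g.cod = k by omega] at this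
  next h1 =>
    split at hs
    next h2 =>
      obtain rfl := Option.some.inj hs
      exact (interchange (D := D) (g := g') (g' := g) (i := k) (k := i) (n := n)
        (by omega) (by omega)).symm
    next => cases hs

theorem par_sound {a b : ℕ × Cell} {s : (ℕ × Cell) × (ℕ × Cell)} {n : ℕ}
    (hs : par a b = some s) (h : (width [b, s.1] n).isSome = true) :
    D.Eqv n [b, s.1] [a, s.2] := by
  obtain ⟨i, g⟩ := a
  obtain ⟨k, g'⟩ := b
  have hw : k + g'.dom ≤ n ∧ s.1.1 + s.1.2.dom ≤ n - g'.dom + g'.cod := by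
    simp only [width, Nat.ble_eq] at h
    constructor <;> · by_contra hc; simp [hc] at h
  simp only [par, Nat.ble_eq] at hs
  split at hs
  next h1 =>
    obtain rfl := Option.some.inj hs
    exact (interchange (D := D) h1 hw.1).symm
  next h1 =>
    split at hs
    next h2 =>
      obtain rfl := Option.some.inj hs
      exact interchange (D := D) h2 (by dsimp only at hw; omega)
    next => cases hs

theorem wf_cons {a : ℕ × Cell} {w : Word} {n : ℕ} (h : (width (a :: w) n).isSome = true) :
    width [a] n = some (n - a.2.dom + a.2.cod) ∧
      (width w (n - a.2.dom + a.2.cod)).isSome = true := by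
  simp only [width] at h ⊢
  split at h
  · exact ⟨by simp_all, h⟩
  · cases h

theorem cons {a : ℕ × Cell} {w w' : Word} {n : ℕ} (h : (width (a :: w) n).isSome = true)
    (e : D.Eqv (n - a.2.dom + a.2.cod) w w') : D.Eqv n (a :: w) (a :: w') :=
  append_left [a] (wf_cons h).1 e

theorem moveUp_sound {w : Word} {b : ℕ × Cell} {s : (ℕ × Cell) × Word} {n : ℕ}
    (hs : moveUp w b = some s) (h : (width (w ++ [b]) n).isSome = true) :
    D.Eqv n (w ++ [b]) (s.1 :: s.2) := by
  induction w generalizing n s with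
  | nil => obtain rfl := Option.some.inj hs; exact refl h
  | cons a w ih =>
    simp only [moveUp, Option.bind_eq_some_iff, Option.map_eq_some_iff] at hs
    obtain ⟨p, hp, q, hq, rfl⟩ := hs
    have h1 : D.Eqv n (a :: (w ++ [b])) (a :: p.1 :: p.2) := cons h (ih hp (wf_cons h).2)
    refine h1.trans ?_
    have h2 : (width ([a, p.1] ++ p.2) n).isSome = true := h1.wf
    refine append_right (swap_sound hq ?_) p.2 h2
    rw [width_append] at h2
    cases hx : width [a, p.1] n with
    | none => simp [hx] at h2
    | some x => rfl

theorem extract_sound {w t : Word} {a : ℕ × Cell} {n : ℕ}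
    (hs : extract w a = some t) (h : (width w n).isSome = true) : D.Eqv n w (a :: t) := by
  induction w generalizing n a t with
  | nil => cases hs
  | cons b w ih =>
    simp only [extract] at hs
    split at hs
    next h1 =>
      obtain rfl := Option.some.inj hs
      obtain rfl := eq_of_layerEq h1
      exact refl h
    next h1 =>
      simp only [Option.bind_eq_some_iff, Option.map_eq_some_iff] at hs
      obtain ⟨s, hs, t', ht, rfl⟩ := hs
      have h1 : D.Eqv n (b :: w) (b :: s.1 :: t') := cons h (ih ht (wf_cons h).2)
      refine h1.trans ?_
      have h2 : (width ([b, s.1] ++ t') n).isSome = true := h1.wf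
      refine append_right (par_sound hs ?_) t' h2
      rw [width_append] at h2
      cases hx : width [b, s.1] n with
      | none => simp [hx] at h2
      | some x => rfl

theorem planarEq_sound {w w' : Word} {n : ℕ} (hs : planarEq w w' = true)
    (h : (width w n).isSome = true) : D.Eqv n w w' := by
  induction w' generalizing n w with
  | nil => simp only [planarEq, List.isEmpty_iff] at hs; subst hs; exact refl h
  | cons a w' ih =>
    simp only [planarEq] at hs
    split at hs
    next => cases hs
    next t ht =>
      have h1 : D.Eqv n w (a :: t) := extract_sound ht h
      exact h1.trans (cons h1.wf (ih hs (wf_cons h1.wf).2))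

theorem middle {n : ℕ} {x y : Word} (a b : Word) (h : (width (a ++ (x ++ b)) n).isSome = true)
    (e : ∀ p, width a n = some p → (width x p).isSome = true → D.Eqv p x y) :
    D.Eqv n (a ++ (x ++ b)) (a ++ (y ++ b)) := by
  cases ha : width a n with
  | none => simp [width_append, ha] at h
  | some p =>
    rw [width_append, ha] at h
    have hx : (width x p).isSome = true := by
      cases hx : width x p with
      | none => simp [width_append, hx] at h
      | some _ => rfl
    exact append_left a ha (append_right (e p ha hx) b h)

/-- The search only interchanges layers, so its three pieces always recompose to the given word,
whether or not the pattern has been found. -/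
theorem find_sound {n : ℕ} (w q u f v : Word) (i : ℕ)
    (h : (width (u ++ (f ++ (v ++ w))) n).isSome = true) :
    D.Eqv n (u ++ (f ++ (v ++ w))) ((find w q u f v i).1 ++
      ((find w q u f v i).2.1 ++ (find w q u f v i).2.2.1)) := by
  induction w generalizing q u f v i with
  | nil => simpa [find] using refl (by simpa using h)
  | cons a w ih =>
    have skip : D.Eqv n (u ++ (f ++ (v ++ a :: w))) ((find w q u f (v ++ [a]) i).1 ++
        ((find w q u f (v ++ [a]) i).2.1 ++ (find w q u f (v ++ [a]) i).2.2.1)) := by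
      have := ih q u f (v ++ [a]) i (by simpa using h)
      simpa using this
    simp only [find]
    split
    · exact refl h
    · split
      next => exact skip
      next a' v' hv =>
        have e1 : D.Eqv n (u ++ (f ++ (v ++ a :: w))) (u ++ (f ++ (a' :: v' ++ w))) := by
          have := middle (D := D) (x := v ++ [a]) (y := a' :: v') (u ++ f) w (n := n)
            (by simpa using h) (fun p _ hx => moveUp_sound hv hx)
          simpa using this
        split
        next q' hq =>
          refine e1.trans ?_
          have := ih q' u (f ++ [a']) v' i (by simpa using e1.wf)
          simpa using this
        next =>
          split
          next => exact skip
          next a'' f' hf =>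
            have e2 : D.Eqv n (u ++ (f ++ (a' :: v' ++ w))) (u ++ (a'' :: f' ++ (v' ++ w))) := by
              have := middle (D := D) (x := f ++ [a']) (y := a'' :: f') u (v' ++ w) (n := n)
                (by simpa using e1.wf) (fun p _ hx => moveUp_sound hf hx)
              simpa using this
            have hw : (width (u ++ [a''] ++ (f' ++ (v' ++ w))) n).isSome = true := by
              simpa using e2.wf
            refine (e1.trans e2).trans ?_
            split
            · simpa using ih q (u ++ [a'']) f' v' i hw
            · simpa using ih _ (u ++ [a'']) f' v' _ hw

theorem pick_sound {n : ℕ} (b : ℕ × Cell) (v w : Word)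
    (h : (width (b :: (v ++ w)) n).isSome = true) :
    D.Eqv n (b :: (v ++ w)) ((pick b v w).1 :: (pick b v w).2) := by
  induction w generalizing b v with
  | nil => simpa [pick] using refl (by simpa using h)
  | cons a w ih =>
    have skip : D.Eqv n (b :: (v ++ a :: w)) ((pick b (v ++ [a]) w).1 ::
        (pick b (v ++ [a]) w).2) := by
      simpa using ih b (v ++ [a]) (by simpa using h)
    simp only [pick]
    split
    next => exact skip
    next c v' hv =>
      split
      next => exact skip
      next c' b' hs =>
        split
        · have e1 : D.Eqv n (b :: (v ++ a :: w)) ([b, c] ++ (v' ++ w)) := by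
            have := middle (D := D) (x := v ++ [a]) (y := c :: v') [b] w (n := n)
              (by simpa using h) (fun p _ hx => moveUp_sound hv hx)
            simpa using this
          have e2 : D.Eqv n ([b, c] ++ (v' ++ w)) ([c', b'] ++ (v' ++ w)) := by
            have := middle (D := D) (x := [b, c]) (y := [c', b']) [] (v' ++ w) (n := n)
              (by simpa using e1.wf) (fun p _ hx => swap_sound hs hx)
            simpa using this
          exact (e1.trans e2).trans (by simpa using ih c' (b' :: v') (by simpa using e2.wf))
        · exact skip

theorem canon_sound (k : ℕ) {n : ℕ} {w : Word} (h : (width w n).isSome = true) :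
    D.Eqv n w (canon k w) := by
  induction k generalizing n w with
  | zero => exact refl h
  | succ k ih =>
    cases w with
    | nil => exact refl h
    | cons a w =>
      have e := pick_sound (D := D) a [] w h
      exact e.trans (cons e.wf (ih (wf_cons e.wf).2))

theorem select_sound {n : ℕ} (s : ℕ) (w u v : Word)
    (h : (width (u ++ (v ++ w)) n).isSome = true) :
    D.Eqv n (u ++ (v ++ w)) (select s w u v) := by
  induction w generalizing s u v with
  | nil => simpa [select] using refl (by simpa using h)
  | cons a w ih =>
    simp only [select]
    split
    · split
      next => exact refl h
      next b v' hv =>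
        have e := middle (D := D) (x := v ++ [a]) (y := b :: v') u w (n := n)
          (by simpa using h) (fun p _ hx => moveUp_sound hv hx)
        have e' : D.Eqv n (u ++ (v ++ a :: w)) (u ++ ([b] ++ (v' ++ w))) := by simpa using e
        exact e'.trans (by simpa using ih (s / 2) (u ++ [b]) v' (by simpa using e'.wf))
    · simpa using ih (s / 2) u (v ++ [a]) (by simpa using h)

theorem normal_sound {n : ℕ} {w : Word} (h : (width w n).isSome = true) :
    D.Eqv n w w.normal := canon_sound _ h

theorem rewrite_sound {m n k i : ℕ} {l r w w' : Word} (e : D.Eqv m l r)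
    (h : (width w n).isSome = true) (hs : rewrite m l r k i n w = some w') : D.Eqv n w w' := by
  simp only [rewrite, Option.bind_eq_some_iff, Option.ite_none_right_eq_some, Bool.and_eq_true,
    Nat.ble_eq] at hs
  obtain ⟨q, hq, ⟨hle, hp⟩, hs⟩ := hs
  obtain rfl := Option.some.inj hs
  have hw : w = w.take k ++ w.drop k := (List.take_append_drop k w).symm
  have e1 : D.Eqv n w (w.take k ++ ((find (w.drop k) (Word.shift i l) [] [] [] i).1 ++
      ((find (w.drop k) (Word.shift i l) [] [] [] i).2.1 ++
        (find (w.drop k) (Word.shift i l) [] [] [] i).2.2.1))) := by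
    conv_lhs => rw [hw]
    cases ha : width (w.take k) n with
    | none => rw [hw, width_append, ha] at h; cases h
    | some p =>
      refine append_left _ ha ?_
      have := find_sound (D := D) (n := p) (w.drop k) (Word.shift i l) [] [] [] i (by
        rw [hw, width_append, ha] at h
        simpa using h)
      simpa using this
  refine e1.trans ?_
  have := middle (D := D) (n := n) (y := Word.shift
      (find (w.drop k) (Word.shift i l) [] [] [] i).2.2.2 r) _ _
    (by rw [List.append_assoc]; exact e1.wf) (fun p hp' hx => by
      rw [hq] at hp'
      obtain rfl := Option.some.inj hp'
      exact (planarEq_sound hp hx).trans (e.shift_of_le hle))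
  simpa using this

end HopfData.Eqv

/-- The replacement of a word by another one, at some height and some offset, after a selection
of layers. -/
structure Step where
  arity : ℕ
  lhs : Word
  rhs : Word
  selection : ℕ
  height : ℕ
  offset : ℕ

/-- The given replacements are valid. -/
def HopfData.Steps (D : HopfData H) (t : List Step) : Prop :=
  ∀ s ∈ t, D.Eqv s.arity s.lhs s.rhs

theorem HopfData.Steps.nil : D.Steps [] := fun _ h => by cases h

/-- Replace the left-hand side by the right-hand side. -/
theorem HopfData.Eqv.fw {n : ℕ} {l r : Word} (h : D.Eqv n l r) (k i : ℕ) {t : List Step}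
    (ht : D.Steps t) : D.Steps (⟨n, l, r, 0, k, i⟩ :: t) :=
  fun _ hs => by
    rcases List.mem_cons.mp hs with rfl | hs
    exacts [h, ht _ hs]

/-- Replace the right-hand side by the left-hand side. -/
theorem HopfData.Eqv.bw {n : ℕ} {l r : Word} (h : D.Eqv n l r) (k i : ℕ) {t : List Step}
    (ht : D.Steps t) : D.Steps (⟨n, r, l, 0, k, i⟩ :: t) :=
  h.symm.fw k i ht

/-- Replace the left-hand side by the right-hand side, below some layers. -/
theorem HopfData.Eqv.fwBelow {n : ℕ} {l r : Word} (h : D.Eqv n l r) (s k i : ℕ) {t : List Step}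
    (ht : D.Steps t) : D.Steps (⟨n, l, r, s, k, i⟩ :: t) :=
  fun _ hs => by
    rcases List.mem_cons.mp hs with rfl | hs
    exacts [h, ht _ hs]

/-- Replace the right-hand side by the left-hand side, below some layers. -/
theorem HopfData.Eqv.bwBelow {n : ℕ} {l r : Word} (h : D.Eqv n l r) (s k i : ℕ) {t : List Step}
    (ht : D.Steps t) : D.Steps (⟨n, r, l, s, k, i⟩ :: t) :=
  h.symm.fwBelow s k i ht

/-- Perform the steps on normal forms, and compare the result with a given word up to
interchange. -/
def Step.check (n : ℕ) (w' : Word) : List Step → Word → Bool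
  | [], w => Word.planarEq w.normal w'.normal
  | s :: t, w =>
    match Word.rewrite s.arity s.lhs.normal s.rhs s.height s.offset n
      (Word.select s.selection w.normal [] []) with
    | none => false
    | some x => check n w' t x

/-- The reflection principle: `e` carries the proofs of the identities used, and `h` is a closed
Boolean computation, which mentions no category. -/
theorem HopfData.Eqv.of_steps {n : ℕ} {w w' : Word} {t : List Step} (e : D.Steps t)
    (h : ((Word.width w n).isSome && (Word.width w' n).isSome && Step.check n w' t w) = true) :
    D.Eqv n w w' := by
  simp only [Bool.and_eq_true] at h
  obtain ⟨⟨hw, hw'⟩, h⟩ := h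
  induction t generalizing w with
  | nil =>
    have e := normal_sound (D := D) hw
    exact (e.trans (planarEq_sound h e.wf)).trans (normal_sound hw').symm
  | cons s t ih =>
    simp only [Step.check] at h
    split at h
    next => cases h
    next x hx =>
      have e1 := normal_sound (D := D) hw
      have e2 := e s List.mem_cons_self
      have e4 := e1.trans (select_sound s.selection _ [] [] e1.wf)
      -- The checker searches for the normal form of the left-hand side, so the identity is first
      -- transported along normalization.
      have e3 := e4.trans (rewrite_sound ((normal_sound e2.wf').symm.trans e2) e4.wf hx)
      exact e3.trans (ih (fun s hs => e s (List.mem_cons_of_mem _ hs)) h e3.wf)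

end Checker

/-! ### The relations as pairs of words -/

namespace Ax

/-- The number of strands entering the diagrams of a relation. -/
def dom : Ax → ℕ
  | a3 => 3
  | a5 | a6 | r5 | r9 | h10 => 2
  | a7 | a8 | i3 | i4 | r6 | r7 | d | n => 0
  | _ => 1

/-- The number of strands leaving the diagrams of a relation. -/
def cod : Ax → ℕ
  | a1 | r7 => 3
  | a5 | a7 | r6 | r8 | r9 | q | h10 => 2
  | a6 | a8 | i3 | i5 | r4 | n => 0
  | _ => 1

/-- The left-hand side of a relation. -/
def lhs : Ax → Word
  | a1 => [(0, .Δ), (0, .Δ)]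
  | a2 => [(0, .Δ), (0, .ε)]
  | a2' => [(0, .Δ), (1, .ε)]
  | a3 => [(0, .m), (0, .m)]
  | a4 => [(1, .η), (0, .m)]
  | a4' => [(0, .η), (0, .m)]
  | a5 => [(0, .Δ), (2, .Δ), (1, .γ), (0, .m), (1, .m)]
  | a6 => [(0, .m), (0, .ε)]
  | a7 => [(0, .η), (0, .Δ)]
  | a8 => [(0, .η), (0, .ε)]
  | s1 => [(0, .Δ), (0, .S), (0, .m)]
  | s1' => [(0, .Δ), (1, .S), (0, .m)]
  | s2 => [(0, .Sinv), (0, .S)]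
  | s2' => [(0, .S), (0, .Sinv)]
  | i1 => [(0, .Δ), (1, .l)]
  | i2 => [(0, .L), (0, .m)]
  | i3 => [(0, .L), (0, .l)]
  | i4 => [(0, .L), (0, .S)]
  | i5 => [(0, .S), (0, .l)]
  | r1 => [(0, .v), (0, .vinv)]
  | r2 => [(0, .vinv), (0, .v)]
  | r3 => [(0, .v), (0, .S)]
  | r4 => [(0, .v), (0, .ε)]
  | r5 => [(0, .v), (0, .m)]
  | r6 => [(0, .σ)]
  | r7 => [(0, .σ), (0, .Δ)]
  | r8 => [(0, .vinv), (0, .Δ)]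
  | r9 => [(0, .σ), (1, .m), (3, .σ), (2, .m), (0, .S), (2, .σ), (1, .m), (2, .m), (1, .γi),
      (2, .σ), (1, .m), (2, .m), (3, .S), (0, .m), (1, .m)]
  | d => [(0, .σ), (0, .l)]
  | n => [(0, .η), (0, .v), (0, .l)]
  | q => [(0, .ε), (0, .σ)]
  | h10 => [(0, .Δ), (1, .γ), (0, .ad)]

/-- The right-hand side of a relation. -/
def rhs : Ax → Word
  | a1 => [(0, .Δ), (1, .Δ)]
  | a2 | a2' | a4 | a4' | a8 | s2 | s2' | i3 | r1 | r2 | n => []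
  | a3 => [(1, .m), (0, .m)]
  | a5 => [(0, .m), (0, .Δ)]
  | a6 => [(0, .ε), (0, .ε)]
  | a7 => [(0, .η), (1, .η)]
  | s1 | s1' => [(0, .ε), (0, .η)]
  | i1 => [(0, .l), (0, .η)]
  | i2 => [(0, .ε), (0, .L)]
  | i4 | d => [(0, .L)]
  | i5 => [(0, .l)]
  | r3 => [(0, .S), (0, .v)]
  | r4 => [(0, .ε)]
  | r5 => [(0, .m), (0, .v)]
  | r6 => [(0, .η), (0, .v), (0, .Δ), (0, .vinv), (1, .S), (1, .vinv)]
  | r7 => [(0, .σ), (1, .σ), (2, .m)]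
  | r8 => [(0, .Δ), (0, .γi), (1, .σ), (0, .m), (1, .m), (0, .vinv), (1, .vinv)]
  | r9 => [(0, .γ)]
  | q => [(1, .σ), (0, .Δ), (1, .γ), (0, .ad), (1, .ad)]
  | h10 => [(0, .Δ), (1, .ad), (0, .γi)]

end Ax

section Relations

variable {C : Type u} [Category.{v} C] [MonoidalCategory C] [BraidedCategory C] {H : C}

namespace HopfData

/-- The two sides of a relation are the values of the words `a.lhs` and `a.rhs`. -/
theorem eval_ax (D : HopfData H) (a : Ax) :
    ∃ (s : ∀ j, strands H (j + a.dom) ≅ (D.eqn a).src ⊗ strands H j)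
      (t : ∀ j, (D.eqn a).tgt ⊗ strands H j ≅ strands H (j + a.cod)), ∀ j,
      D.eval a.lhs (j + a.dom) = ⟨j + a.cod, (s j).hom ≫ (D.eqn a).lhs ▷ strands H j ≫ (t j).hom⟩ ∧
      D.eval a.rhs (j + a.dom) = ⟨j + a.cod, (s j).hom ≫ (D.eqn a).rhs ▷ strands H j ≫ (t j).hom⟩ := by
  cases a
  case a1 =>
    -- In every case the two isomorphisms only rebracket or remove units, so that coherence closes
    -- the goals.
    refine ⟨fun _ => Iso.refl _, fun _ => α_ _ _ _ ≪≫ whiskerLeftIso _ (α_ _ _ _), fun j =>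
      ⟨Sigma.ext rfl (heq_of_eq ?_), Sigma.ext rfl (heq_of_eq ?_)⟩⟩ <;>
      (dsimp [Ax.lhs, Ax.rhs, Ax.dom, Ax.cod, eqn, eval, layer, cell, Out.lift, strands, rhoL,
        rhoR, mu, adj, pow, tensorμ, MonoidalCategory.whiskerLeftIso]
       try simp only [MonoidalCategory.tensorHom_def]
       monoidal)
  case a2 | a2' | a4 | a4' | s1 | s1' | s2 | s2' | i1 | i2 | r1 | r2 | r3 =>
    refine ⟨fun _ => Iso.refl _, fun _ => Iso.refl _, fun j =>
      ⟨Sigma.ext rfl (heq_of_eq ?_), Sigma.ext rfl (heq_of_eq ?_)⟩⟩ <;>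
      (dsimp [Ax.lhs, Ax.rhs, Ax.dom, Ax.cod, eqn, eval, layer, cell, Out.lift, strands, rhoL,
        rhoR, mu, adj, pow, tensorμ, MonoidalCategory.whiskerLeftIso]
       try simp only [MonoidalCategory.tensorHom_def]
       monoidal)
  case a3 =>
    refine ⟨fun _ => (α_ _ _ _ ≪≫ α_ _ _ _).symm, fun _ => Iso.refl _, fun j =>
      ⟨Sigma.ext rfl (heq_of_eq ?_), Sigma.ext rfl (heq_of_eq ?_)⟩⟩ <;>
      (dsimp [Ax.lhs, Ax.rhs, Ax.dom, Ax.cod, eqn, eval, layer, cell, Out.lift, strands, rhoL,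
        rhoR, mu, adj, pow, tensorμ, MonoidalCategory.whiskerLeftIso]
       try simp only [MonoidalCategory.tensorHom_def]
       monoidal)
  case a5 | r9 | h10 =>
    refine ⟨fun _ => (α_ _ _ _).symm, fun _ => α_ _ _ _, fun j =>
      ⟨Sigma.ext rfl (heq_of_eq ?_), Sigma.ext rfl (heq_of_eq ?_)⟩⟩ <;>
      (dsimp [Ax.lhs, Ax.rhs, Ax.dom, Ax.cod, eqn, eval, layer, cell, Out.lift, strands, rhoL,
        rhoR, mu, adj, pow, tensorμ, MonoidalCategory.whiskerLeftIso]
       try simp only [MonoidalCategory.tensorHom_def]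
       monoidal)
  case a6 =>
    refine ⟨fun _ => (α_ _ _ _).symm, fun _ => λ_ _, fun j =>
      ⟨Sigma.ext rfl (heq_of_eq ?_), Sigma.ext rfl (heq_of_eq ?_)⟩⟩ <;>
      (dsimp [Ax.lhs, Ax.rhs, Ax.dom, Ax.cod, eqn, eval, layer, cell, Out.lift, strands, rhoL,
        rhoR, mu, adj, pow, tensorμ, MonoidalCategory.whiskerLeftIso]
       try simp only [MonoidalCategory.tensorHom_def]
       monoidal)
  case a7 | r6 =>
    refine ⟨fun _ => (λ_ _).symm, fun _ => α_ _ _ _, fun j =>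
      ⟨Sigma.ext rfl (heq_of_eq ?_), Sigma.ext rfl (heq_of_eq ?_)⟩⟩ <;>
      (dsimp [Ax.lhs, Ax.rhs, Ax.dom, Ax.cod, eqn, eval, layer, cell, Out.lift, strands, rhoL,
        rhoR, mu, adj, pow, tensorμ, MonoidalCategory.whiskerLeftIso]
       try simp only [MonoidalCategory.tensorHom_def]
       monoidal)
  case a8 | i3 | n =>
    refine ⟨fun _ => (λ_ _).symm, fun _ => λ_ _, fun j =>
      ⟨Sigma.ext rfl (heq_of_eq ?_), Sigma.ext rfl (heq_of_eq ?_)⟩⟩ <;>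
      (dsimp [Ax.lhs, Ax.rhs, Ax.dom, Ax.cod, eqn, eval, layer, cell, Out.lift, strands, rhoL,
        rhoR, mu, adj, pow, tensorμ, MonoidalCategory.whiskerLeftIso]
       try simp only [MonoidalCategory.tensorHom_def]
       monoidal)
  case i4 | d =>
    refine ⟨fun _ => (λ_ _).symm, fun _ => Iso.refl _, fun j =>
      ⟨Sigma.ext rfl (heq_of_eq ?_), Sigma.ext rfl (heq_of_eq ?_)⟩⟩ <;>
      (dsimp [Ax.lhs, Ax.rhs, Ax.dom, Ax.cod, eqn, eval, layer, cell, Out.lift, strands, rhoL,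
        rhoR, mu, adj, pow, tensorμ, MonoidalCategory.whiskerLeftIso]
       try simp only [MonoidalCategory.tensorHom_def]
       monoidal)
  case i5 | r4 =>
    refine ⟨fun _ => Iso.refl _, fun _ => λ_ _, fun j =>
      ⟨Sigma.ext rfl (heq_of_eq ?_), Sigma.ext rfl (heq_of_eq ?_)⟩⟩ <;>
      (dsimp [Ax.lhs, Ax.rhs, Ax.dom, Ax.cod, eqn, eval, layer, cell, Out.lift, strands, rhoL,
        rhoR, mu, adj, pow, tensorμ, MonoidalCategory.whiskerLeftIso]
       try simp only [MonoidalCategory.tensorHom_def]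
       monoidal)
  case r5 =>
    refine ⟨fun _ => (α_ _ _ _).symm, fun _ => Iso.refl _, fun j =>
      ⟨Sigma.ext rfl (heq_of_eq ?_), Sigma.ext rfl (heq_of_eq ?_)⟩⟩ <;>
      (dsimp [Ax.lhs, Ax.rhs, Ax.dom, Ax.cod, eqn, eval, layer, cell, Out.lift, strands, rhoL,
        rhoR, mu, adj, pow, tensorμ, MonoidalCategory.whiskerLeftIso]
       try simp only [MonoidalCategory.tensorHom_def]
       monoidal)
  case r7 =>
    refine ⟨fun _ => (λ_ _).symm, fun _ => α_ _ _ _ ≪≫ whiskerLeftIso _ (α_ _ _ _), fun j =>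
      ⟨Sigma.ext rfl (heq_of_eq ?_), Sigma.ext rfl (heq_of_eq ?_)⟩⟩ <;>
      (dsimp [Ax.lhs, Ax.rhs, Ax.dom, Ax.cod, eqn, eval, layer, cell, Out.lift, strands, rhoL,
        rhoR, mu, adj, pow, tensorμ, MonoidalCategory.whiskerLeftIso]
       try simp only [MonoidalCategory.tensorHom_def]
       monoidal)
  case r8 =>
    refine ⟨fun _ => Iso.refl _, fun _ => α_ _ _ _, fun j =>
      ⟨Sigma.ext rfl (heq_of_eq ?_), Sigma.ext rfl (heq_of_eq ?_)⟩⟩ <;>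
      (dsimp [Ax.lhs, Ax.rhs, Ax.dom, Ax.cod, eqn, eval, layer, cell, Out.lift, strands, rhoL,
        rhoR, mu, adj, pow, tensorμ, MonoidalCategory.whiskerLeftIso]
       try simp only [MonoidalCategory.tensorHom_def]
       monoidal)
  case q =>
    refine ⟨fun _ => whiskerLeftIso _ (λ_ _).symm ≪≫ (α_ _ _ _).symm, fun _ => α_ _ _ _, fun j =>
      ⟨Sigma.ext rfl (heq_of_eq ?_), Sigma.ext rfl (heq_of_eq ?_)⟩⟩ <;>
      (dsimp [Ax.lhs, Ax.rhs, Ax.dom, Ax.cod, eqn, eval, layer, cell, Out.lift, strands, rhoL,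
        rhoR, mu, adj, pow, tensorμ, MonoidalCategory.whiskerLeftIso]
       try simp only [MonoidalCategory.tensorHom_def]
       monoidal)

end HopfData
end Relations

/-! ### Relations as identities of words, and naturality of the braiding -/

section Braiding

set_option linter.unusedSimpArgs false
set_option linter.unusedSectionVars false

variable {C : Type u} [Category.{v} C] [MonoidalCategory C] [BraidedCategory C] {H : C}
  {D : HopfData H}

namespace HopfData

/-- A relation holds if and only if its two sides are equal as words. -/
theorem holds_iff (a : Ax) : D.Holds a ↔ D.Eqv a.dom a.lhs a.rhs := by
  obtain ⟨s, t, h⟩ := D.eval_ax a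
  refine ⟨fun e => ⟨by cases a <;> rfl, by cases a <;> rfl, fun j => ?_⟩, fun e => ?_⟩
  · rw [(h j).1, (h j).2, show (D.eqn a).lhs = (D.eqn a).rhs from e]
  · have e0 := e.eval_eq 0
    rw [(h 0).1, (h 0).2] at e0
    have e1 := eq_of_heq (Sigma.mk.inj e0).2
    rw [cancel_epi, cancel_mono] at e1
    -- With no further strand on the right, the whiskering is by the unit object, hence faithful.
    exact (MonoidalCategory.whiskerRight_iff _ _).mp e1

theorem braid_braidInv : D.Eqv 2 [(0, .γ), (0, .γi)] [] := by
  refine ⟨rfl, rfl, fun j => Sigma.ext rfl (heq_of_eq ?_)⟩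
  dsimp [eval, layer, cell, Out.lift, strands]
  simp [← MonoidalCategory.comp_whiskerRight_assoc]

theorem braidInv_braid : D.Eqv 2 [(0, .γi), (0, .γ)] [] := by
  refine ⟨rfl, rfl, fun j => Sigma.ext rfl (heq_of_eq ?_)⟩
  dsimp [eval, layer, cell, Out.lift, strands]
  simp [← MonoidalCategory.comp_whiskerRight_assoc]

theorem ad_eqv : D.Eqv 2 [(0, .ad)] [(0, .Δ), (1, .γ), (0, .m), (1, .S), (0, .m)] := by
  refine ⟨rfl, rfl, fun j => Sigma.ext rfl (heq_of_eq ?_)⟩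
  dsimp [eval, layer, cell, Out.lift, strands, adjOne]
  simp only [MonoidalCategory.tensorHom_def]
  monoidal

/-- Crossings of `k` strands with a strand that starts on their right. -/
def _root_.Word.passLeft (c : Cell) : ℕ → Word
  | 0 => []
  | k + 1 => (k, c) :: Word.passLeft c k

/-- Crossings of `k` strands with a strand that starts on their left. -/
def _root_.Word.passRight (c : Cell) (k : ℕ) : Word := (List.range k).map fun i => (i, c)

/-- The morphism underlying an elementary diagram. -/
def mor (D : HopfData H) : (g : Cell) → (pow H g.dom ⟶ pow H g.cod)
  | .Δ => D.Δ | .ε => D.ε | .m => D.m | .η => D.η | .S => D.S | .Sinv => D.Sinv | .L => D.L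
  | .l => D.l | .v => D.v | .vinv => D.vinv | .σ => D.σ
  | .γ => (β_ H H).hom | .γi => (β_ H H).inv | .ad => D.adjOne

/-- The natural equalities between a morphism on the leftmost strands and its whiskerings. -/
theorem whisker_congr {X Y : C} {f g : X ⟶ Y} (h : f = g) (Z : C) {A B : C}
    [MonoidalCoherence A (X ⊗ Z)] [MonoidalCoherence (Y ⊗ Z) B] :
    (𝟙 A ⊗≫ f ▷ Z ⊗≫ 𝟙 B) = 𝟙 A ⊗≫ g ▷ Z ⊗≫ 𝟙 B := by rw [h]

/-- Naturality of the braiding, with the braiding of a power of H split into single crossings by the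
hexagons. For `f = .γ` this is the braid relation. -/
theorem braid_left (f : Cell) : D.Eqv (f.dom + 1) ((0, f) :: Word.passLeft .γ f.cod)
    (Word.passLeft .γ f.dom ++ [(1, f)]) := by
  refine ⟨by cases f <;> rfl, by cases f <;> rfl, fun j => ?_⟩
  have key := BraidedCategory.braiding_naturality_left (D.mor f) H
  cases f <;>
  · dsimp only [mor, Cell.dom, Cell.cod, pow] at key
    try simp only [BraidedCategory.braiding_tensor_left_hom, BraidedCategory.braiding_tensor_right_hom,
      BraidedCategory.braiding_tensor_left_inv, BraidedCategory.braiding_tensor_right_inv,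
      braiding_tensorUnit_left, braiding_tensorUnit_right, braiding_inv_tensorUnit_left,
      braiding_inv_tensorUnit_right] at key
    refine Sigma.ext rfl (heq_of_eq ?_)
    dsimp [eval, layer, cell, Out.lift, strands, Word.passLeft, Word.passRight, List.range,
      List.range.loop, List.map, Cell.dom, Cell.cod]
    refine Eq.trans ?_ (Eq.trans (whisker_congr key (strands H j)) ?_) <;> monoidal

theorem braid_right (f : Cell) : D.Eqv (f.dom + 1) ((1, f) :: Word.passRight .γ f.cod)
    (Word.passRight .γ f.dom ++ [(0, f)]) := by
  refine ⟨by cases f <;> rfl, by cases f <;> rfl, fun j => ?_⟩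
  have key := BraidedCategory.braiding_naturality_right H (D.mor f)
  cases f <;>
  · dsimp only [mor, Cell.dom, Cell.cod, pow] at key
    try simp only [BraidedCategory.braiding_tensor_left_hom, BraidedCategory.braiding_tensor_right_hom,
      BraidedCategory.braiding_tensor_left_inv, BraidedCategory.braiding_tensor_right_inv,
      braiding_tensorUnit_left, braiding_tensorUnit_right, braiding_inv_tensorUnit_left,
      braiding_inv_tensorUnit_right] at key
    refine Sigma.ext rfl (heq_of_eq ?_)
    dsimp [eval, layer, cell, Out.lift, strands, Word.passLeft, Word.passRight, List.range,
      List.range.loop, List.map, Cell.dom, Cell.cod]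
    refine Eq.trans ?_ (Eq.trans (whisker_congr key (strands H j)) ?_) <;> monoidal

theorem braidInv_left (f : Cell) : D.Eqv (f.dom + 1) ((0, f) :: Word.passLeft .γi f.cod)
    (Word.passLeft .γi f.dom ++ [(1, f)]) := by
  refine ⟨by cases f <;> rfl, by cases f <;> rfl, fun j => ?_⟩
  have key := BraidedCategory.braiding_inv_naturality_left (D.mor f) H
  cases f <;>
  · dsimp only [mor, Cell.dom, Cell.cod, pow] at key
    try simp only [BraidedCategory.braiding_tensor_left_hom, BraidedCategory.braiding_tensor_right_hom,
      BraidedCategory.braiding_tensor_left_inv, BraidedCategory.braiding_tensor_right_inv,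
      braiding_tensorUnit_left, braiding_tensorUnit_right, braiding_inv_tensorUnit_left,
      braiding_inv_tensorUnit_right] at key
    refine Sigma.ext rfl (heq_of_eq ?_)
    dsimp [eval, layer, cell, Out.lift, strands, Word.passLeft, Word.passRight, List.range,
      List.range.loop, List.map, Cell.dom, Cell.cod]
    refine Eq.trans ?_ (Eq.trans (whisker_congr key (strands H j)) ?_) <;> monoidal

theorem braidInv_right (f : Cell) : D.Eqv (f.dom + 1) ((1, f) :: Word.passRight .γi f.cod)
    (Word.passRight .γi f.dom ++ [(0, f)]) := by
  refine ⟨by cases f <;> rfl, by cases f <;> rfl, fun j => ?_⟩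
  have key := BraidedCategory.braiding_inv_naturality_right H (D.mor f)
  cases f <;>
  · dsimp only [mor, Cell.dom, Cell.cod, pow] at key
    try simp only [BraidedCategory.braiding_tensor_left_hom, BraidedCategory.braiding_tensor_right_hom,
      BraidedCategory.braiding_tensor_left_inv, BraidedCategory.braiding_tensor_right_inv,
      braiding_tensorUnit_left, braiding_tensorUnit_right, braiding_inv_tensorUnit_left,
      braiding_inv_tensorUnit_right] at key
    refine Sigma.ext rfl (heq_of_eq ?_)
    dsimp [eval, layer, cell, Out.lift, strands, Word.passLeft, Word.passRight, List.range,
      List.range.loop, List.map, Cell.dom, Cell.cod]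
    refine Eq.trans ?_ (Eq.trans (whisker_congr key (strands H j)) ?_) <;> monoidal

end HopfData
end Braiding

/-! ### The core relations -/

/-- The relations that are common to the two presentations. -/
def Ax.isCore : Ax → Bool
  | .r8 | .r9 | .q | .h10 => false
  | _ => true

section Core

variable {C : Type u} [Category.{v} C] [MonoidalCategory C] [BraidedCategory C] {H : C}

namespace HopfData

/-- The common relations are satisfied. -/
def Core (D : HopfData H) : Prop := ∀ a : Ax, a.isCore = true → D.Holds a

variable {D : HopfData H}

theorem Core.ax (h : D.Core) (a : Ax) (ha : a.isCore = true := by rfl) :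
    D.Eqv a.dom a.lhs a.rhs := (D.holds_iff a).mp (h a ha)

end HopfData
end Core

section Certificates

variable {C : Type u} [Category.{v} C] [MonoidalCategory C] [BraidedCategory C] {H : C}
  {D : HopfData H}
namespace HopfData
open Eqv

/-! ### The antipode -/

theorem Core.antipode_unit (h : D.Core) : D.Eqv 0 [(0, .η), (0, .S)] [(0, .η)] :=
  .of_steps ((h.ax .a4).bw 2 0 <| (h.ax .a7).bw 0 0 <| (h.ax .s1).fw 0 0 <|
    (h.ax .a8).fw 0 0 .nil) (by decide +kernel)

theorem Core.counit_antipode (h : D.Core) : D.Eqv 1 [(0, .S), (0, .ε)] [(0, .ε)] :=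
  .of_steps ((h.ax .a2').bw 0 0 <| (h.ax .a6).bw 0 0 <| (h.ax .s1).fw 0 0 <|
    (h.ax .a8).fw 0 0 .nil) (by decide +kernel)

/-- Both sides are convolution inverses of `m`; the steps insert one inverse through (s1') and
cancel the other through (s1). -/
theorem Core.mul_antipode (h : D.Core) : D.Eqv 2 [(0, .m), (0, .S)] [(0, .γ), (0, .S), (1, .S),
    (0, .m)] :=
  .of_steps ((h.ax .a2').bw 0 0 <| (braid_left .ε).fw 0 1 <| (h.ax .a4).bw 5 0 <|
    (h.ax .s1').bw 0 1 <| (braid_left .Δ).bw 0 1 <| (h.ax .a1).bw 0 0 <| (h.ax .a4).bw 4 2 <|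
    (h.ax .a2').bw 3 2 <| (h.ax .s1').bw 0 2 <| (h.ax .a3).bw 0 1 <| (h.ax .a1).bw 0 2 <|
    (h.ax .a3).fw 9 1 <| (h.ax .a3).bw 9 0 <| (braid_right .Δ).bw 0 2 <| (h.ax .a5).fw 1 0 <|
    (h.ax .s1).fw 1 0 <| (h.ax .a4').fw 0 2 <| (braid_right .Δ).fw 0 1 <| (h.ax .a6).fw 0 0 <|
    (h.ax .a2).fw 1 0 <| (h.ax .a2).fw 0 0 .nil) (by decide +kernel)

/-- The dual argument: both sides are convolution inverses of `Δ`. -/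
theorem Core.antipode_comul (h : D.Core) : D.Eqv 1 [(0, .S), (0, .Δ)] [(0, .Δ), (0, .S), (1, .S),
    (0, .γ)] :=
  .of_steps ((h.ax .a4).bw 2 0 <| (braid_right .η).bw 0 1 <| (h.ax .a2').bw 0 0 <|
    (h.ax .s1').bw 0 0 <| (braid_right .m).fw 0 1 <| (h.ax .a3).bw 0 0 <| (h.ax .a4).bw 5 2 <|
    (h.ax .a2').bw 4 2 <| (h.ax .s1').bw 1 2 <| (h.ax .a1).bw 4 2 <| (h.ax .a1).fw 1 2 <|
    (h.ax .a3).bw 0 1 <| (h.ax .a1).bw 0 0 <| (h.ax .a5).fw 2 0 <| (h.ax .s1).fw 1 0 <|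
    (h.ax .a2).fw 0 0 <| (h.ax .a7).fw 0 0 <| (h.ax .a4').fw 0 0 <|
    (h.ax .a4').fw 0 0 .nil) (by decide +kernel)

theorem Core.antipodeInv_unit (h : D.Core) : D.Eqv 0 [(0, .η), (0, .Sinv)] [(0, .η)] :=
  .of_steps (h.antipode_unit.bw 0 0 <| (h.ax .s2').fw 0 0 .nil) (by decide +kernel)

theorem Core.mul_antipodeInv (h : D.Core) : D.Eqv 2 [(0, .m), (0, .Sinv)] [(0, .γi), (0, .Sinv),
    (1, .Sinv), (0, .m)] :=
  .of_steps (braidInv_braid.bw 0 0 <| (h.ax .s2).bw 1 1 <| (h.ax .s2).bw 1 0 <|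
    (braid_left .S).fw 0 0 <| (braid_right .S).fw 0 0 <| h.mul_antipode.bw 0 0 <|
    (h.ax .s2').fw 0 0 .nil) (by decide +kernel)

/-! ### The ribbon morphism and the copairing -/

/-- The antipode reverses products and commutes with `v`, so it carries (r5) to its mirror image.
Thus vη is central. -/
theorem Core.v_right (h : D.Core) : D.Eqv 2 [(1, .v), (0, .m)] [(0, .m), (0, .v)] :=
  .of_steps ((h.ax .s2').bw 2 0 <| h.mul_antipode.fw 0 0 <| (braid_right .v).fw 0 0 <|
    (h.ax .r3).fw 0 0 <| (h.ax .r5).fw 0 0 <| h.mul_antipode.bw 0 0 <| (h.ax .r3).bw 0 0 <|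
    (h.ax .s2').fw 0 0 .nil) (by decide +kernel)

theorem Core.vinv_left (h : D.Core) : D.Eqv 2 [(0, .vinv), (0, .m)] [(0, .m), (0, .vinv)] :=
  .of_steps ((h.ax .r1).bw 2 0 <| (h.ax .r5).bw 0 0 <| (h.ax .r2).fw 0 0 .nil) (by decide +kernel)

theorem Core.vinv_right (h : D.Core) : D.Eqv 2 [(1, .vinv), (0, .m)] [(0, .m), (0, .vinv)] :=
  .of_steps ((h.ax .r1).bw 2 0 <| h.v_right.bw 0 0 <| (h.ax .r2).fw 0 1 .nil) (by decide +kernel)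

theorem Core.antipode_vinv (h : D.Core) : D.Eqv 1 [(0, .S), (0, .vinv)] [(0, .vinv), (0, .S)] :=
  .of_steps ((h.ax .r2).bw 0 0 <| (h.ax .r3).fw 0 0 <| (h.ax .r1).fw 0 0 .nil) (by decide +kernel)

theorem Core.antipodeInv_v (h : D.Core) : D.Eqv 1 [(0, .Sinv), (0, .v)] [(0, .v), (0, .Sinv)] :=
  .of_steps ((h.ax .s2').bw 2 0 <| (h.ax .r3).fw 0 0 <|
    (h.ax .s2).fw 0 0 .nil) (by decide +kernel)

theorem Core.counit_vinv (h : D.Core) : D.Eqv 1 [(0, .vinv), (0, .ε)] [(0, .ε)] :=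
  .of_steps ((h.ax .r4).bw 0 0 <| (h.ax .r2).fw 0 0 .nil) (by decide +kernel)

theorem Core.sigma_counit_left (h : D.Core) : D.Eqv 0 [(0, .σ), (0, .ε)] [(0, .η)] :=
  .of_steps ((h.ax .r6).fw 0 0 <| h.counit_vinv.fw 0 0 <| (h.ax .a2).fw 0 0 <|
    h.antipode_vinv.fw 0 0 <| (h.ax .r1).fw 0 0 <|
    h.antipode_unit.fw 0 0 .nil) (by decide +kernel)

theorem Core.sigma_counit_right (h : D.Core) : D.Eqv 0 [(0, .σ), (1, .ε)] [(0, .η)] :=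
  .of_steps ((h.ax .r6).fw 0 0 <| h.counit_vinv.fw 1 1 <| h.counit_antipode.fw 1 1 <|
    (h.ax .a2').fw 0 0 <| (h.ax .r1).fw 0 0 .nil) (by decide +kernel)

/-- This is (r6) solved for Δ(vη). -/
theorem Core.unit_v_comul (h : D.Core) : D.Eqv 0 [(0, .η), (0, .v), (0, .Δ)] [(0, .σ), (0, .v),
    (1, .v), (1, .Sinv)] :=
  .of_steps ((h.ax .s2').bw 3 1 <| (h.ax .r2).bw 4 1 <| (h.ax .r2).bw 3 0 <|
    (h.ax .r6).bw 0 0 .nil) (by decide +kernel)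

/-- The antipode fixes vη and reverses coproducts; comparing S(vη) and vη after `Δ` gives a symmetry
of σ. -/
theorem Core.sigma_flip (h : D.Core) : D.Eqv 0 [(0, .σ), (0, .S), (0, .γ)] [(0, .σ), (1, .Sinv)] :=
  .of_steps ((h.ax .r1).bw 2 0 <| (h.ax .r1).bw 1 1 <| (h.ax .r3).bw 0 0 <|
    (braid_left .vinv).fw 0 0 <| (h.ax .s2).bw 4 1 <| h.unit_v_comul.bw 0 0 <|
    (braid_right .vinv).fw 0 0 <| h.antipode_comul.bw 0 0 <| (h.ax .r3).fw 0 0 <|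
    h.antipode_unit.fw 0 0 <| h.unit_v_comul.fw 0 0 <| h.antipodeInv_v.bw 1 1 <|
    (h.ax .r1).fw 1 1 <| (h.ax .r1).fw 0 0 .nil) (by decide +kernel)

theorem Core.sigma_flip_sq (h : D.Core) : D.Eqv 0 [(0, .σ), (0, .S), (0, .S), (0, .γ)] [(0, .σ)] :=
  .of_steps ((braid_left .S).fw 2 0 <| h.sigma_flip.fw 0 0 <|
    (h.ax .s2).fw 1 1 .nil) (by decide +kernel)

/-- The counterpart of (r7) for the right leg, obtained by carrying (r7) across the symmetry
`sigma_flip_sq`. -/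
theorem Core.comul_right_sigma (h : D.Core) : D.Eqv 0 [(0, .σ), (1, .Δ)] [(0, .σ), (1, .σ),
    (0, .m)] :=
  .of_steps (h.sigma_flip_sq.bw 0 0 <| (braid_left .Δ).bw 0 0 <| h.antipode_comul.fw 2 0 <|
    h.antipode_comul.fw 0 0 <| (h.ax .r7).fw 0 0 <| (braid_left .S).bw 0 0 <|
    (braid_right .S).fw 0 0 <| (braid_left .γ).fw 5 0 <| (braid_right .m).fw 1 1 <|
    (braid_right .σ).fw 0 0 <| h.sigma_flip_sq.fw 1 2 <| (braid_right .m).fw 0 0 <|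
    h.sigma_flip_sq.fw 0 0 <| (braid_right .σ).fw 1 1 .nil) (by decide +kernel)

theorem Core.sigma_mul_antipode (h : D.Core) : D.Eqv 0 [(0, .σ), (1, .σ), (2, .S), (0, .m),
    (1, .m)] [(0, .η), (1, .η)] :=
  .of_steps (h.comul_right_sigma.bw 0 0 <| (h.ax .s1).fw 1 1 <|
    h.sigma_counit_right.fw 0 0 .nil) (by decide +kernel)

theorem Core.antipode_sigma_mul (h : D.Core) : D.Eqv 0 [(0, .σ), (0, .S), (1, .σ), (0, .m),
    (1, .m)] [(0, .η), (1, .η)] :=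
  .of_steps ((h.ax .r7).bw 0 0 <| (h.ax .s1).fw 0 0 <|
    h.sigma_counit_left.fw 0 0 .nil) (by decide +kernel)

/-- For the nested product a₁b₁ ⊗ b₂a₂ of copairings, one side is a left inverse of σ and the other
a right inverse. -/
theorem Core.antipode_sigma (h : D.Core) : D.Eqv 0 [(0, .σ), (0, .S)] [(0, .σ), (1, .S)] :=
  .of_steps ((h.ax .a4).bw 2 0 <| (h.ax .a4').bw 1 1 <| h.sigma_mul_antipode.bw 1 1 <|
    (h.ax .a3).bw 0 0 <| (h.ax .a3).fw 1 1 <| h.antipode_sigma_mul.fw 0 0 <| (h.ax .a4').fw 0 0 <|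
    (h.ax .a4).fw 1 1 .nil) (by decide +kernel)

theorem Core.sigma_flip_antipodes (h : D.Core) : D.Eqv 0 [(0, .σ), (0, .S), (1, .S), (0, .γ)]
    [(0, .σ)] :=
  .of_steps (h.antipode_sigma.bw 0 0 <| h.sigma_flip_sq.fw 0 0 .nil) (by decide +kernel)

theorem Core.sigma_antipode_mul (h : D.Core) : D.Eqv 0 [(0, .σ), (1, .σ), (1, .S), (0, .m),
    (1, .m)] [(0, .η), (1, .η)] :=
  .of_steps (h.antipode_sigma.fw 1 1 <| h.sigma_mul_antipode.fw 0 0 .nil) (by decide +kernel)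

theorem Core.sigma_inv_mul_sigma (h : D.Core) : D.Eqv 0 [(0, .σ), (1, .Sinv), (2, .σ), (1, .γ),
    (0, .m), (1, .m)] [(0, .η), (1, .η)] :=
  .of_steps ((h.ax .s2').bw 6 1 <| h.mul_antipode.fw 1 1 <| (braid_right .σ).fw 1 1 <|
    (h.ax .s2).fw 1 2 <| h.antipode_sigma.bw 1 1 <| h.sigma_antipode_mul.fw 0 0 <|
    h.antipodeInv_unit.fw 1 1 .nil) (by decide +kernel)

/-- Δ(vη) and Δ(v⁻¹η) are inverse to each other in the braided algebra H ⊗ H, and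
`sigma_inv_mul_sigma` inverts the expression for Δ(vη). -/
theorem Core.unit_vinv_comul (h : D.Core) : D.Eqv 0 [(0, .η), (0, .vinv), (0, .Δ)] [(0, .σ),
    (0, .vinv), (1, .vinv)] :=
  .of_steps ((h.ax .a4).bw 3 0 <| (braid_right .η).bw 1 1 <| (h.ax .a4).bw 5 2 <|
    h.sigma_inv_mul_sigma.bw 1 1 <| (h.ax .a3).bw 8 1 <| (braid_right .m).fw 1 1 <|
    (braid_left .m).bw 2 2 <| (h.ax .a3).bw 0 0 <| (h.ax .r1).bw 2 1 <| (h.ax .r1).bw 10 2 <|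
    h.antipodeInv_v.fw 2 2 <| h.unit_v_comul.bw 1 1 <| h.vinv_right.fw 8 1 <|
    (braid_right .vinv).fw 1 1 <| h.vinv_right.fw 0 0 <| (h.ax .a5).fw 0 0 <|
    h.vinv_left.fw 0 0 <| (h.ax .a4').fw 0 0 <| (h.ax .r1).fw 0 0 <| (h.ax .a7).fw 0 0 <|
    h.vinv_left.fw 0 0 <| (h.ax .a4').fw 0 0 <| (braid_left .vinv).fw 0 0 <|
    (braid_left .η).fw 0 0 <| h.vinv_left.fw 1 1 <| (h.ax .a4').fw 1 1 .nil) (by decide +kernel)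

/-! ### Adjoint invariance of the copairing -/

/-- Since vη is central, Δ(vη) commutes with Δ(x); the factors `v` are then cancelled. -/
theorem Core.sigma_inv_comm (h : D.Core) : D.Eqv 1 [(0, .σ), (1, .Sinv), (2, .Δ), (1, .γ), (0, .m),
    (1, .m)] [(0, .Δ), (2, .σ), (3, .Sinv), (1, .γ), (0, .m), (1, .m)] :=
  .of_steps ((h.ax .r1).bw 2 1 <| (h.ax .r1).bw 1 0 <| h.antipodeInv_v.fw 0 1 <|
    h.unit_v_comul.bw 0 0 <| (braid_left .vinv).fw 0 1 <| h.vinv_left.fw 0 1 <|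
    h.vinv_left.fw 0 0 <| (h.ax .a5).fw 0 0 <| (h.ax .r5).fw 0 0 <| (h.ax .a4').fw 0 0 <|
    (h.ax .a4).bw 0 0 <| h.v_right.bw 0 0 <| (h.ax .a5).bw 0 0 <| h.unit_v_comul.fw 0 1 <|
    h.vinv_right.bw 0 0 <| h.vinv_right.bw 0 1 <| h.antipodeInv_v.bw 3 2 <| (h.ax .r1).fw 3 2 <|
    (braid_right .vinv).bw 0 1 <| (h.ax .r1).fw 1 2 .nil) (by decide +kernel)

theorem Core.mul_sigma_comm (h : D.Core) : D.Eqv 1 [(0, .Δ), (1, .σ), (3, .S), (0, .m), (1, .m)]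
    [(0, .σ), (1, .γ), (1, .Δ), (2, .S), (0, .m), (1, .m)] :=
  .of_steps ((h.ax .s2).bw 2 2 <| (braid_right .σ).bw 0 1 <| (braid_right .Sinv).bw 3 1 <|
    h.mul_antipode.bw 3 1 <| h.sigma_inv_comm.bw 0 0 <| h.mul_antipode.fw 0 1 <|
    (braid_right .Δ).fw 0 1 <| (braid_left .S).bw 0 1 <|
    (h.ax .s2).fw 0 1 .nil) (by decide +kernel)

/-- Up to crossings, xσ₁ ⊗ σ₂ = σ₁x₁ ⊗ S(x₂)σ₂x₃: multiply `mul_sigma_comm` by a third copy of x to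
cancel an antipode. -/
theorem Core.mul_sigma_left (h : D.Core) : D.Eqv 1 [(0, .Δ), (0, .Δ), (0, .σ), (1, .γ), (2, .γ),
    (2, .S), (0, .m), (1, .m), (1, .m)] [(1, .σ), (0, .m)] :=
  .of_steps ((braid_right .Δ).fw 2 1 <| h.mul_sigma_comm.bw 0 0 <| (h.ax .a1).fw 0 0 <|
    (h.ax .a3).fw 0 1 <| (h.ax .s1).fw 1 2 <| (h.ax .a4).fw 0 0 <|
    (h.ax .a2').fw 0 0 .nil) (by decide +kernel)

theorem Core.sigma_flip_antipodeInvs (h : D.Core) : D.Eqv 0 [(0, .σ), (0, .γi), (0, .Sinv),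
    (1, .Sinv)] [(0, .σ)] :=
  .of_steps (h.sigma_flip_antipodes.bw 0 0 <| braid_braidInv.fw 0 0 <| (h.ax .s2').fw 1 1 <|
    (h.ax .s2').fw 0 0 .nil) (by decide +kernel)

theorem Core.antipode_comul3 (h : D.Core) : D.Eqv 1 [(0, .S), (0, .Δ), (0, .Δ)] [(0, .Δ), (0, .Δ),
    (0, .S), (1, .S), (2, .S), (1, .γ), (0, .γ), (1, .γ)] :=
  .of_steps (h.antipode_comul.fw 0 0 <| (braid_right .Δ).bw 0 0 <| h.antipode_comul.fw 0 1 <|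
    (h.ax .a1).bw 0 0 .nil) (by decide +kernel)

theorem Core.mul3_antipodeInv (h : D.Core) : D.Eqv 3 [(0, .m), (0, .m), (0, .Sinv)] [(0, .Sinv),
    (1, .Sinv), (2, .Sinv), (0, .γi), (1, .γi), (0, .γi), (0, .m), (0, .m)] :=
  .of_steps (h.mul_antipodeInv.fw 1 0 <| (braidInv_left .Sinv).bw 0 0 <|
    (braidInv_right .Sinv).bw 0 0 <| h.mul_antipodeInv.fw 0 0 <| (braidInv_left .m).fw 0 0 <|
    (braidInv_right .Sinv).bw 0 0 <| (braidInv_left .Sinv).bw 0 0 <|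
    (h.ax .a3).bw 0 0 .nil) (by decide +kernel)

/-- The mirror image of `mul_sigma_left`, in the form x₁σ₁S(x₂) ⊗ x₃σ₂ = σ₁ ⊗ σ₂x up to crossings.
It is carried over by the inverse antipode and σ = (S⁻¹ ⊗ S⁻¹)γ⁻¹σ; most steps only slide strands
through crossings. -/
theorem Core.mul_sigma_right (h : D.Core) : D.Eqv 1 [(0, .Δ), (0, .Δ), (3, .σ), (2, .γ), (1, .γ),
    (2, .S), (0, .m), (0, .m), (1, .m)] [(0, .σ), (1, .m)] :=
  .of_steps ((braid_left .S).bw 0 1 <| h.sigma_flip_antipodeInvs.bw 0 1 <|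
    (braid_right .Sinv).fw 1 2 <| (braidInv_left .σ).bw 0 0 <| (braidInv_left .γi).bw 0 0 <|
    (braidInv_right .Δ).bw 2 0 <| braidInv_braid.fw 1 2 <| (braid_left .S).fw 0 1 <|
    (braid_right .Sinv).fw 0 1 <| (braidInv_right .Δ).bw 2 0 <| braidInv_braid.fw 3 1 <|
    (braidInv_left .Sinv).bw 0 1 <| (braidInv_left .Sinv).bw 2 0 <|
    (braidInv_right .Sinv).bw 0 0 <| (braidInv_left .Sinv).bw 0 0 <| (braidInv_right .Δ).bw 0 1 <|
    -- In `bwBelow` the first numeral is a bit mask of layers to be brought to the top; the height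
    -- that follows is its number of ones, so that the crossings are inserted just below these
    -- layers.
    (braidInv_right .Δ).bw 0 1 <| (braidInv_right .S).bw 7 1 <| braid_braidInv.bwBelow 1663 9 1 <|
    (braidInv_right .γ).bw 0 1 <| braid_braidInv.bw 9 0 <| (braidInv_right .γ).bw 0 0 <|
    braid_braidInv.bw 7 3 <| braid_braidInv.bwBelow 2168 5 0 <| (braid_left .γ).fw 1 2 <|
    braid_braidInv.bw 8 1 <| (braidInv_right .γ).bw 0 1 <| (braidInv_right .γ).fw 8 1 <|
    braid_braidInv.fw 0 1 <| (braid_left .γ).bw 1 2 <| braid_braidInv.fw 7 2 <|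
    braid_braidInv.fw 1 3 <| (braid_left .Sinv).fw 0 1 <| (braidInv_left .Sinv).fw 0 0 <|
    (braidInv_left .Sinv).fw 0 1 <| (braidInv_right .Sinv).fw 0 1 <|
    (braidInv_left .Sinv).fw 1 2 <| (h.ax .s2').bw 11 2 <| (braidInv_right .S).bw 1 2 <|
    (braid_left .S).bw 1 2 <| (h.ax .s2').bw 8 0 <| (braidInv_right .S).bw 0 0 <|
    (h.ax .s2').bw 2 3 <| braid_braidInv.bwBelow 1048638 6 1 <|
    braid_braidInv.bwBelow 24638 7 0 <| (braid_left .γ).fw 1 2 <| braid_braidInv.bw 8 1 <|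
    (braidInv_right .γ).bw 0 1 <| (braidInv_right .S).bw 0 1 <| h.mul3_antipodeInv.bw 0 0 <|
    (braidInv_right .m).bw 0 0 <| (braidInv_right .m).bw 0 1 <| (braidInv_right .m).bw 0 0 <|
    (braidInv_right .m).bw 0 1 <| (braidInv_left .Sinv).fw 0 1 <| (braidInv_right .Sinv).fw 0 1 <|
    h.mul_antipodeInv.bw 15 1 <| (braidInv_left .m).bw 0 0 <| h.antipode_comul3.bw 1 2 <|
    h.mul_sigma_left.fw 0 0 <| (braidInv_left .Sinv).bw 0 0 <| h.mul_antipodeInv.fw 0 0 <|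
    (braidInv_left .S).fw 0 0 <| (h.ax .s2').fw 0 1 <| (braidInv_left .m).fw 0 0 <|
    (braidInv_right .σ).fw 0 0 <| (braidInv_left .Sinv).fw 0 0 <|
    h.sigma_flip_antipodeInvs.fw 0 0 .nil) (by decide +kernel)

/-- Multiplying `mul_sigma_right` on the right by the antipode of one more copy of x leaves σ alone.
-/
theorem Core.sigma_ad (h : D.Core) : D.Eqv 1 [(1, .σ), (0, .Δ), (1, .γ), (0, .ad), (1, .ad)]
    [(0, .ε), (0, .σ)] :=
  .of_steps (ad_eqv.fw 0 1 <| (braid_left .Δ).bw 0 1 <| (braid_right .σ).fw 0 0 <|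
    (h.ax .a1).bw 0 0 <| ad_eqv.fw 0 0 <| h.mul_sigma_right.fw 1 0 <| (h.ax .a3).fw 0 1 <|
    (h.ax .s1').fw 1 2 <| (h.ax .a4).fw 0 1 .nil) (by decide +kernel)

/-! ### Integrals and nondegeneracy of the copairing -/

theorem Core.cointegral_left (h : D.Core) : D.Eqv 1 [(0, .Δ), (0, .l)] [(0, .l), (0, .η)] :=
  .of_steps ((h.ax .s2').bw 1 1 <| (h.ax .i5).bw 0 0 <| (braid_left .l).fw 0 0 <|
    (braid_right .S).bw 0 0 <| h.antipode_comul.bw 0 0 <| (h.ax .i1).fw 0 0 <|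
    (h.ax .i5).fw 0 0 <| h.antipodeInv_unit.fw 0 0 .nil) (by decide +kernel)

theorem Core.integral_antipodeInv (h : D.Core) : D.Eqv 0 [(0, .L), (0, .Sinv)] [(0, .L)] :=
  .of_steps ((h.ax .i4).bw 0 0 <| (h.ax .s2').fw 0 0 .nil) (by decide +kernel)

theorem Core.integral_right (h : D.Core) : D.Eqv 1 [(1, .L), (0, .m)] [(0, .ε), (0, .L)] :=
  .of_steps ((h.ax .s2').bw 2 0 <| h.mul_antipode.fw 0 0 <| (braid_right .L).fw 0 0 <|
    (h.ax .i4).fw 0 0 <| (h.ax .i2).fw 0 0 <| h.integral_antipodeInv.fw 0 1 <|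
    h.counit_antipode.fw 0 0 .nil) (by decide +kernel)

/-- By (r6), lv on the left leg becomes `l` on the left of Δ(vη), which leaves l(vη) = 1 by (n). -/
theorem Core.cointegral_v_sigma (h : D.Core) : D.Eqv 0 [(0, .σ), (0, .v), (0, .l)] [(0, .η),
    (0, .vinv)] :=
  .of_steps ((h.ax .s2).bw 1 1 <| (h.ax .r1).bw 4 0 <| h.antipodeInv_v.fw 0 0 <|
    h.unit_v_comul.bw 0 0 <| h.cointegral_left.fw 0 0 <| (h.ax .n).fw 0 0 <|
    h.antipode_vinv.bw 0 0 <| h.antipode_unit.fw 0 0 .nil) (by decide +kernel)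

theorem Core.sigma_cointegral (h : D.Core) : D.Eqv 0 [(0, .σ), (1, .l)] [(0, .L)] :=
  .of_steps (h.sigma_flip_antipodes.bw 0 0 <| (braid_left .l).bw 0 0 <| (h.ax .i5).fw 0 0 <|
    (h.ax .d).fw 0 0 <| (h.ax .i4).fw 0 0 .nil) (by decide +kernel)

/-- The classical formula S(x) = L₁ l(xL₂), up to crossings: insert S(x₁)x₂, then absorb the product
of x and `L` by the two-sided integral. -/
theorem Core.antipode_eq_integral (h : D.Core) : D.Eqv 1 [(1, .L), (1, .Δ), (0, .γ), (1, .m),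
    (1, .l)] [(0, .S)] :=
  .of_steps ((h.ax .a4').bw 3 0 <| (h.ax .a2).bw 0 0 <| (h.ax .s1).bw 0 0 <| (h.ax .a3).fw 0 0 <|
    (h.ax .a1).fw 0 0 <| (h.ax .a5).fw 0 1 <| h.integral_right.fw 0 0 <| (h.ax .a2').fw 0 0 <|
    (h.ax .i1).fw 0 1 <| (h.ax .a4).fw 0 0 <| (h.ax .i3).fw 0 1 .nil) (by decide +kernel)

theorem Core.comul_integral (h : D.Core) : D.Eqv 0 [(0, .L), (0, .Δ)] [(0, .σ), (1, .σ), (2, .m),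
    (2, .l)] :=
  .of_steps (h.sigma_cointegral.bw 0 0 <| (h.ax .r7).fw 0 0 .nil) (by decide +kernel)

/-- Writing ΔL through two copies of σ in `antipode_eq_integral`, the identity of H is obtained from
the left leg of a copairing. Hence morphisms out of H that agree on the left leg of σ are equal. -/
theorem Core.sigma_nondegenerate (h : D.Core) : D.Eqv 1 [(0, .Sinv), (0, .σ), (1, .γi), (2, .σ),
    (1, .m), (1, .l), (1, .m), (1, .l)] [] :=
  .of_steps ((braidInv_right .Sinv).fw 0 1 <| braidInv_braid.bw 2 0 <|
    (braidInv_left .σ).fw 0 0 <| (braid_left .Sinv).bw 0 0 <| h.comul_integral.bw 0 1 <|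
    h.antipode_eq_integral.fw 0 0 <| (h.ax .s2).fw 0 0 .nil) (by decide +kernel)

theorem Core.sigma_comul_cointegral_left (h : D.Core) : D.Eqv 0 [(0, .σ), (0, .Δ), (0, .v),
    (0, .l)] [(0, .σ), (1, .vinv)] :=
  .of_steps ((h.ax .r7).fw 0 0 <| h.cointegral_v_sigma.fw 0 0 <| h.vinv_right.fw 1 1 <|
    (h.ax .a4).fw 1 1 .nil) (by decide +kernel)

theorem Core.sigma_comul_cointegral_right (h : D.Core) : D.Eqv 0 [(0, .σ), (0, .Δ), (1, .v),
    (1, .l)] [(0, .σ), (1, .vinv)] :=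
  .of_steps ((h.ax .r7).fw 0 0 <| h.cointegral_v_sigma.fw 1 1 <| h.vinv_left.fw 1 1 <|
    (h.ax .a4').fw 1 1 .nil) (by decide +kernel)

/-- On the left leg of σ both sides give (id ⊗ v⁻¹)σ, by the two preceding lemmas. -/
theorem Core.cointegral_v_cocentral (h : D.Core) : D.Eqv 1 [(0, .Δ), (0, .v), (0, .l)] [(0, .Δ),
    (1, .v), (1, .l)] :=
  .of_steps (h.sigma_nondegenerate.bw 0 0 <| h.sigma_comul_cointegral_left.fw 0 0 <|
    h.sigma_comul_cointegral_right.bw 0 0 <|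
    h.sigma_nondegenerate.fw 0 0 .nil) (by decide +kernel)

/-! ### Comultiplication of the inverse ribbon morphism -/

theorem Core.sigma_mul_cointegral_aux (h : D.Core) : D.Eqv 0 [(0, .σ), (1, .σ), (0, .m), (0, .v),
    (0, .l)] [(0, .σ), (0, .Δ), (0, .v), (0, .l), (0, .vinv)] :=
  .of_steps (h.comul_right_sigma.bw 0 0 <| h.cointegral_v_sigma.fw 0 0 <|
    h.unit_vinv_comul.fw 0 0 <| h.sigma_comul_cointegral_left.bw 0 0 .nil) (by decide +kernel)

theorem Core.sigma_nondegenerate' (h : D.Core) : D.Eqv 1 [(0, .Sinv), (0, .σ), (1, .γi), (2, .σ),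
    (1, .m), (1, .l), (1, .m), (0, .γ), (0, .l)] [] :=
  .of_steps ((braid_right .l).bw 0 0 <| h.sigma_nondegenerate.fw 0 0 .nil) (by decide +kernel)

theorem Core.sigma_mul_cointegral (h : D.Core) : D.Eqv 1 [(1, .σ), (0, .m), (0, .v), (0, .l)]
    [(0, .Δ), (0, .v), (0, .l), (0, .vinv)] :=
  .of_steps (h.sigma_nondegenerate'.bw 0 0 <| (braid_right .l).bw 0 0 <| (braid_left .l).fw 0 1 <|
    (braid_left .l).fw 0 1 <| (braid_left .l).fw 8 2 <| (braid_right .σ).fw 1 2 <|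
    (braid_left .l).bw 0 1 <| h.sigma_mul_cointegral_aux.fw 0 0 <|
    h.sigma_nondegenerate.fw 0 0 .nil) (by decide +kernel)

/-- This lemma and the next evaluate lv on either side of Δ(xσ₁); cocentrality of lv then equates
the results. -/
theorem Core.cointegral_comul_sigma_left (h : D.Core) : D.Eqv 1 [(1, .σ), (0, .m), (0, .Δ),
    (0, .v), (0, .l)] [(0, .Δ), (0, .Δ), (0, .v), (0, .l), (0, .vinv), (0, .γi), (1, .σ), (0, .m),
    (1, .m)] :=
  .of_steps ((h.ax .a5).bw 0 0 <| (h.ax .r7).fw 0 1 <| braid_braidInv.bwBelow 13 3 2 <|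
    (braid_right .σ).fw 0 0 <| h.sigma_mul_cointegral.fw 0 0 .nil) (by decide +kernel)

theorem Core.cointegral_comul_sigma_right (h : D.Core) : D.Eqv 1 [(1, .σ), (0, .m), (0, .Δ),
    (1, .v), (1, .l)] [(0, .Δ), (0, .v), (0, .l), (0, .Δ), (2, .σ), (1, .γ), (0, .m), (1, .m),
    (1, .vinv)] :=
  .of_steps ((h.ax .a5).bw 0 0 <| (h.ax .r7).fw 0 1 <| h.sigma_mul_cointegral.fw 0 1 <|
    (braid_left .Δ).bw 0 1 <| (braid_left .v).bw 0 1 <| (braid_left .l).bw 0 1 <|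
    (braid_left .vinv).bw 0 1 <| (h.ax .a1).bw 0 0 <| h.cointegral_v_cocentral.bw 2 0 <|
    (h.ax .a1).fw 0 0 <| (braid_left .vinv).fw 0 1 <| h.vinv_left.fw 0 1 .nil) (by decide +kernel)

theorem Core.cointegral_comul_sigma (h : D.Core) : D.Eqv 1 [(0, .Δ), (0, .Δ), (0, .v), (0, .l),
    (0, .γi), (1, .σ), (0, .m), (1, .m)] [(0, .Δ), (0, .v), (0, .l), (0, .Δ), (2, .σ), (1, .γ),
    (0, .m), (1, .m)] :=
  .of_steps ((h.ax .r2).bw 8 1 <| h.vinv_right.bw 0 1 <| (braidInv_left .vinv).bw 0 0 <|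
    h.cointegral_comul_sigma_left.bw 0 0 <| h.cointegral_v_cocentral.fw 0 0 <|
    h.cointegral_comul_sigma_right.fw 0 0 <| (h.ax .r2).fw 0 1 .nil) (by decide +kernel)

/-- On a leg of σ, contracting `Δ` with lv amounts to the invertible v⁻¹ on the other leg, so lv can
be removed from `cointegral_comul_sigma`. -/
theorem Core.comul_sigma_aux (h : D.Core) : D.Eqv 0 [(0, .σ), (0, .Δ), (0, .γi), (1, .σ), (0, .m),
    (1, .m)] [(0, .σ), (0, .Δ), (2, .σ), (1, .γ), (0, .m), (1, .m)] :=
  .of_steps ((h.ax .r2).bw 1 1 <| h.sigma_comul_cointegral_left.bw 0 0 <| (h.ax .a1).bw 0 0 <|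
    h.cointegral_comul_sigma.fw 0 0 <| h.sigma_comul_cointegral_left.fw 0 0 <|
    (h.ax .r2).fw 1 2 .nil) (by decide +kernel)

theorem Core.comul_sigma (h : D.Core) : D.Eqv 1 [(0, .Δ), (0, .γi), (1, .σ), (0, .m), (1, .m)]
    [(0, .Δ), (2, .σ), (1, .γ), (0, .m), (1, .m)] :=
  .of_steps (h.sigma_nondegenerate.bw 0 0 <| h.comul_sigma_aux.fw 0 0 <|
    h.sigma_nondegenerate.fw 0 0 .nil) (by decide +kernel)

/-- Write v⁻¹(x) as the product of x and v⁻¹η, apply `Δ`, and replace the braided product Δ(x) · σ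
by means of `comul_sigma`. -/
theorem Core.vinv_comul (h : D.Core) : D.Eqv 1 [(0, .vinv), (0, .Δ)] [(0, .Δ), (0, .γi), (1, .σ),
    (0, .m), (1, .m), (0, .vinv), (1, .vinv)] :=
  .of_steps ((h.ax .a4).bw 0 0 <| h.vinv_right.bw 0 0 <| (h.ax .a5).bw 0 0 <|
    h.unit_vinv_comul.fw 0 1 <| h.vinv_right.fw 3 1 <| (braid_right .vinv).fw 0 1 <|
    h.vinv_right.fw 0 0 <| h.comul_sigma.bw 0 0 .nil) (by decide +kernel)

/-! ### The left side of (r9) as an adjoint action -/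

theorem Core.sigma_twist (h : D.Core) : D.Eqv 2 [(1, .σ), (1, .γi), (0, .γi), (2, .γi), (1, .γi)]
    [(0, .γi), (1, .σ), (1, .S), (2, .S), (2, .γ), (0, .γ)] :=
  .of_steps ((braid_left .σ).bw 0 0 <| (braidInv_left .γ).fw 0 0 <| braid_braidInv.fw 0 1 <|
    h.sigma_flip_antipodes.bw 0 0 <| braid_braidInv.fw 0 0 <| (braidInv_left .γ).fw 0 1 <|
    (braidInv_left .S).fw 0 1 <| braidInv_braid.bwBelow 13 3 0 <| (braidInv_left .σ).fw 0 0 <|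
    (braid_right .S).bw 0 0 .nil) (by decide +kernel)

/-- The part of `conj_ad_eq` that involves no product: four copairings, crossings and antipodes. -/
theorem Core.sigma_conj (h : D.Core) : D.Eqv 2 [(0, .γi), (1, .σ), (2, .σ), (3, .σ), (4, .σ),
    (2, .γ), (0, .γ), (1, .γ), (0, .γ), (0, .S), (1, .S), (8, .γ), (7, .γ), (8, .γ), (8, .S),
    (9, .S)] [(0, .σ), (3, .σ), (6, .σ), (3, .γi), (2, .γi), (1, .γi), (4, .γi), (3, .γi),
    (2, .γi), (5, .γi), (4, .γi), (3, .γi), (4, .σ), (0, .S), (9, .S)] :=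
  .of_steps ((braidInv_left .σ).bw 0 2 <| braidInv_braid.fw 0 2 <| (braid_left .S).bw 5 0 <|
    (braid_right .S).bw 12 8 <| (braid_right .S).bw 0 0 <| (braid_left .S).bw 4 8 <|
    braid_braidInv.bw 7 2 <| (braid_right .σ).fw 0 1 <| (braidInv_left .σ).bw 2 0 <|
    braidInv_braid.fw 0 0 <| braid_braidInv.bwBelow 14364 6 2 <| (braid_left .σ).fw 1 4 <|
    (braidInv_right .σ).bw 4 5 <| braidInv_braid.fw 5 8 <|
    h.sigma_twist.bw 0 2 .nil) (by decide +kernel)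

/-- Both legs of the single σ are comultiplied in the adjoint actions; splitting each coproduct
produces the four copies of σ that occur in (r9). -/
theorem Core.conj_ad_eq (h : D.Core) : D.Eqv 2 [(0, .γi), (1, .σ), (1, .Δ), (0, .γ), (0, .S),
    (0, .m), (0, .m), (1, .ad)] [(0, .σ), (1, .m), (3, .σ), (2, .m), (0, .S), (2, .σ), (1, .m),
    (2, .m), (1, .γi), (2, .σ), (1, .m), (2, .m), (3, .S), (0, .m), (1, .m)] :=
  .of_steps (ad_eqv.fw 0 1 <| h.comul_right_sigma.fw 0 1 <| (h.ax .a5).bw 0 1 <|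
    (h.ax .r7).fw 0 2 <| (h.ax .r7).fw 0 1 <| (braid_left .m).fw 0 2 <| (braid_right .m).fw 0 0 <|
    (h.ax .a3).bw 0 0 <| h.mul_antipode.fw 0 2 <| (h.ax .a3).bw 0 1 <| h.mul_antipode.fw 0 0 <|
    h.sigma_conj.fw 0 0 <| (h.ax .a3).fw 0 0 <| (h.ax .a3).fw 0 0 <| (h.ax .a3).fw 16 1 <|
    (h.ax .a3).fw 16 1 <| (h.ax .a3).fw 0 0 <| (h.ax .a3).fw 0 1 <| (braidInv_left .m).bw 8 3 <|
    (braidInv_left .m).bw 5 2 <| (braidInv_left .m).bw 0 1 <| (braidInv_right .m).bw 6 2 <|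
    (braidInv_right .m).bw 0 1 <| (braidInv_right .m).bw 1 3 <| (braidInv_right .m).bw 0 2 <|
    (braidInv_left .m).bw 0 1 .nil) (by decide +kernel)

/-! ### The adjoint action and the relation (h10) -/

theorem Core.ad_mul (h : D.Core) : D.Eqv 3 [(0, .m), (0, .ad)] [(1, .ad), (0, .ad)] :=
  .of_steps (ad_eqv.fw 0 0 <| (h.ax .a5).bw 0 0 <| (braid_left .m).fw 0 1 <|
    h.mul_antipode.fw 0 1 <| (h.ax .a3).bw 0 0 <| (braid_left .γ).bw 0 1 <|
    (braid_right .Δ).fw 0 1 <| (h.ax .a3).fw 0 0 <| (h.ax .a3).fw 0 0 <| ad_eqv.bw 0 1 <|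
    (braid_right .ad).bw 0 1 <| ad_eqv.bw 0 0 .nil) (by decide +kernel)

theorem Core.ad_unit (h : D.Core) : D.Eqv 1 [(0, .η), (0, .ad)] [] :=
  .of_steps (ad_eqv.fw 0 0 <| (h.ax .a7).fw 0 0 <| (h.ax .a4').fw 0 0 <| (braid_left .η).fw 0 0 <|
    h.antipode_unit.fw 0 1 <| (h.ax .a4).fw 0 0 .nil) (by decide +kernel)

theorem Core.comul_antipodeInv_mul (h : D.Core) : D.Eqv 1 [(0, .Δ), (0, .γi), (1, .Sinv), (0, .m)]
    [(0, .ε), (0, .η)] :=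
  .of_steps ((h.ax .s2').bw 2 0 <| (braidInv_right .S).bw 0 0 <| h.mul_antipodeInv.bw 0 0 <|
    (h.ax .s1').fw 0 0 <| h.antipodeInv_unit.fw 0 0 .nil) (by decide +kernel)

theorem Core.v_comul (h : D.Core) : D.Eqv 1 [(0, .v), (0, .Δ)] [(0, .σ), (1, .Sinv), (2, .Δ),
    (1, .γ), (0, .m), (1, .m), (0, .v), (1, .v)] :=
  .of_steps ((h.ax .a4').bw 0 0 <| (h.ax .r5).bw 0 0 <| (h.ax .a5).bw 0 0 <|
    h.unit_v_comul.fw 0 0 <| h.antipodeInv_v.bw 0 1 <| (braid_left .v).fw 0 1 <|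
    (h.ax .r5).fw 0 1 <| (h.ax .r5).fw 0 0 .nil) (by decide +kernel)

/-- Compares the formulas for Δv and Δv⁻¹, using that `v` followed by `vinv` is the identity. -/
theorem Core.comul_sigma_antipode (h : D.Core) : D.Eqv 1 [(0, .Δ), (0, .γi), (1, .σ), (0, .γ),
    (0, .S), (0, .m), (1, .m)] [(0, .Δ), (1, .σ), (1, .S), (0, .m), (1, .m)] :=
  .of_steps ((braidInv_left .σ).bw 0 0 <| braidInv_braid.fw 0 0 <| braid_braidInv.bw 2 0 <|
    h.sigma_flip.fw 0 0 <| (braidInv_right .m).bw 0 0 <| braid_braidInv.bw 3 1 <|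
    (braidInv_right .m).bw 0 1 <| (braidInv_left .m).bw 0 0 <| (h.ax .r1).bw 6 1 <|
    (h.ax .r1).bw 5 0 <| (braidInv_right .vinv).fw 0 0 <| h.v_comul.bw 0 0 <|
    (braidInv_left .vinv).fw 0 0 <| (h.ax .a4').bw 5 1 <| (h.ax .a4).bw 5 0 <|
    h.sigma_antipode_mul.bw 0 1 <| (h.ax .a3).bw 0 0 <| (h.ax .a3).fw 0 1 <|
    h.vinv_right.fw 2 2 <| h.vinv_left.fw 0 0 <| h.vinv_comul.bw 0 0 <|
    (h.ax .r1).fw 0 0 .nil) (by decide +kernel)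

theorem Core.comul_conj_sigma (h : D.Core) : D.Eqv 1 [(0, .Δ), (0, .γi), (1, .σ), (1, .Δ), (0, .γ),
    (0, .S), (0, .m), (0, .m), (1, .m)] [(0, .Δ)] :=
  .of_steps ((h.ax .r7).fw 0 1 <| (h.ax .a3).fw 0 1 <| h.comul_sigma_antipode.fw 0 0 <|
    (h.ax .a3).bw 0 1 <| (h.ax .a3).fw 0 0 <| h.antipode_sigma_mul.fw 0 1 <| (h.ax .a4').fw 1 2 <|
    (h.ax .a4).fw 0 0 .nil) (by decide +kernel)

/-- By `comul_conj_sigma`, Δ(x) is γ⁻¹Δ(x) with the right leg of σ multiplied into its second factor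
and the left leg acting on its first; the action property of α₁ separates that leg from x. -/
theorem Core.comul_ad (h : D.Core) : D.Eqv 2 [(0, .Δ), (1, .ad)] [(0, .Δ), (0, .γi), (1, .ad),
    (1, .σ), (1, .Δ), (0, .γ), (0, .S), (0, .m), (0, .m), (1, .ad)] :=
  .of_steps (h.comul_conj_sigma.bw 0 0 <| h.ad_mul.fw 0 1 .nil) (by decide +kernel)

/-- Acting with S⁻¹ of one copy of x undoes the action of the next copy, since S⁻¹ is an antipode
for the opposite coproduct. The last three layers thus form a split epimorphism. -/
theorem Core.comul_ad_inv (h : D.Core) : D.Eqv 2 [(0, .Δ), (0, .γi), (1, .Sinv), (1, .ad), (0, .Δ),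
    (0, .γi), (1, .ad)] [] :=
  .of_steps (h.ad_mul.bw 0 1 <| (braidInv_right .Δ).bw 0 0 <| (braidInv_left .Sinv).bw 0 1 <|
    (braidInv_left .m).bw 0 0 <| (h.ax .a1).bw 0 0 <| h.comul_antipodeInv_mul.fw 1 0 <|
    (braidInv_left .η).fw 0 0 <| h.ad_unit.fw 0 1 <| (h.ax .a2).fw 0 0 .nil) (by decide +kernel)

theorem Core.h10_of_conj (h : D.Core) (hc : D.Eqv 2 [(1, .σ), (1, .Δ), (0, .γ), (0, .S), (0, .m),
    (0, .m), (1, .ad)] [(0, .γ), (0, .γ)]) : D.Eqv 2 [(0, .Δ), (1, .γ), (0, .ad)] [(0, .Δ),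
    (1, .ad), (0, .γi)] :=
  .of_steps (braidInv_braid.bw 1 0 <| (braid_right .ad).bw 0 0 <| braid_braidInv.bw 4 0 <|
    hc.bw 0 0 <| h.comul_ad.bw 0 0 .nil) (by decide +kernel)

/-- Preceded by the split epimorphism, both sides become (id ⊗ α₁)Δ, by `comul_ad` and by (h10);
then cancel it. -/
theorem Core.conj_of_h10 (h : D.Core) (h10 : D.Eqv 2 (Ax.lhs .h10) (Ax.rhs .h10)) : D.Eqv 2
    [(1, .σ), (1, .Δ), (0, .γ), (0, .S), (0, .m), (0, .m), (1, .ad)] [(0, .γ), (0, .γ)] :=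
  .of_steps (h.comul_ad_inv.bw 0 0 <| h.comul_ad.bw 1 0 <| braidInv_braid.bw 6 0 <| h10.bw 1 0 <|
    braidInv_braid.bw 3 0 <| (braid_right .ad).bw 0 0 <|
    h.comul_ad_inv.fw 0 0 .nil) (by decide +kernel)

theorem Core.r9_of_conj (h : D.Core) (hc : D.Eqv 2 [(1, .σ), (1, .Δ), (0, .γ), (0, .S), (0, .m),
    (0, .m), (1, .ad)] [(0, .γ), (0, .γ)]) : D.Eqv 2 [(0, .σ), (1, .m), (3, .σ), (2, .m), (0, .S),
    (2, .σ), (1, .m), (2, .m), (1, .γi), (2, .σ), (1, .m), (2, .m), (3, .S), (0, .m), (1, .m)]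
    [(0, .γ)] :=
  .of_steps (h.conj_ad_eq.bw 0 0 <| hc.fw 0 0 <| braidInv_braid.fw 0 0 .nil) (by decide +kernel)

theorem Core.conj_of_r9 (h : D.Core) (h9 : D.Eqv 2 (Ax.lhs .r9) (Ax.rhs .r9)) : D.Eqv 2 [(1, .σ),
    (1, .Δ), (0, .γ), (0, .S), (0, .m), (0, .m), (1, .ad)] [(0, .γ), (0, .γ)] :=
  .of_steps (braid_braidInv.bw 0 0 <| h.conj_ad_eq.fw 0 0 <| h9.fw 0 0 .nil) (by decide +kernel)

end HopfData

end Certificates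

/-! ### The two equivalences of relations -/

section MainResult

variable {C : Type u} [Category.{v} C] [MonoidalCategory C] [BraidedCategory C] {H : C}
  {D : HopfData H}

namespace HopfData.Core

theorem holds_r8 (h : D.Core) : D.Holds .r8 := (holds_iff .r8).mpr h.vinv_comul

theorem holds_q (h : D.Core) : D.Holds .q := (holds_iff .q).mpr h.sigma_ad.symm

theorem holds_r9_iff (h : D.Core) : D.Holds .r9 ↔ D.Holds .h10 := by
  rw [holds_iff, holds_iff]
  exact ⟨fun e => h.h10_of_conj (h.conj_of_r9 e), fun e => h.r9_of_conj (h.conj_of_h10 e)⟩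

end HopfData.Core

end MainResult

/-! ### Comparison of the universal categories -/

namespace Cong

/-- A congruence that identifies the two sides of the relations `R` contains the congruence
generated by `R`. -/
theorem of_le {R R' : DiagRel} (h : ∀ ⦃m n : ℕ⦄ (f g : Diag m n), R f g → Cong R' f g) {m n : ℕ}
    {f g : Diag m n} (e : Cong R f g) : Cong R' f g := by
  induction e with
  | base e => exact h _ _ e
  | refl f => exact .refl f
  | symm _ ih => exact .symm ih
  | trans _ _ ih ih' => exact .trans ih ih'
  | comp _ _ ih ih' => exact .comp ih ih'
  | tensor _ _ ih ih' => exact .tensor ih ih'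
  | id_comp f => exact .id_comp f
  | comp_id f => exact .comp_id f
  | assoc f g h => exact .assoc f g h
  | tensor_id m n => exact .tensor_id m n
  | tensor_comp f g f' g' => exact .tensor_comp f g f' g'
  | tensor_assoc f g h => exact .tensor_assoc f g h
  | unit_tensor f => exact .unit_tensor f
  | tensor_unit f => exact .tensor_unit f
  | braid_inv m n => exact .braid_inv m n
  | inv_braid m n => exact .inv_braid m n
  | braid_nat f g => exact .braid_nat f g
  | hexagon m n p => exact .hexagon m n p
  | hexagon' m n p => exact .hexagon' m n p

end Cong

namespace Pres

variable {R R' : DiagRel}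

/-- `Cong R` is already an equivalence relation, so the quotient identifies nothing more. -/
theorem exact {m n : ℕ} {f g : Diag m n} (h : ofDiag R f = ofDiag R g) : Cong R f g :=
  ((⟨.refl, .symm, .trans⟩ : Equivalence (Cong R (m := m) (n := n))).quot_mk_eq_iff f g).mp h

/-- The map of classes of diagrams induced by an inclusion of congruences. -/
def mapHom (h : ∀ ⦃m n : ℕ⦄ (f g : Diag m n), R f g → Cong R' f g) {m n : ℕ} :
    Hom R m n → Hom R' m n :=
  Quot.map id fun _ _ => Cong.of_le h

/-- The functor induced by an inclusion of congruences. -/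
def mapFunctor (h : ∀ ⦃m n : ℕ⦄ (f g : Diag m n), R f g → Cong R' f g) : Pres R ⥤ Pres R' where
  obj X := ⟨X.arity⟩
  map f := mapHom h f
  map_id _ := rfl
  map_comp := by rintro _ _ _ ⟨f⟩ ⟨g⟩; rfl

/-- The functor `mapFunctor h` is strictly monoidal. -/
def mapFunctorCore (h : ∀ ⦃m n : ℕ⦄ (f g : Diag m n), R f g → Cong R' f g) :
    (mapFunctor h).CoreMonoidal where
  εIso := Iso.refl _
  μIso _ _ := Iso.refl _
  μIso_hom_natural_left := by
    rintro _ _ ⟨f⟩ _; exact (Category.comp_id _).trans (Category.id_comp _).symm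
  μIso_hom_natural_right := by
    rintro _ _ _ ⟨f⟩; exact (Category.comp_id _).trans (Category.id_comp _).symm
  associativity X Y Z := by
    let X' : Pres R' := ⟨X.arity⟩
    let Y' : Pres R' := ⟨Y.arity⟩
    let Z' : Pres R' := ⟨Z.arity⟩
    change 𝟙 (X' ⊗ Y') ▷ Z' ≫ 𝟙 ((X' ⊗ Y') ⊗ Z') ≫ (α_ X' Y' Z').hom =
      (α_ X' Y' Z').hom ≫ X' ◁ 𝟙 (Y' ⊗ Z') ≫ 𝟙 (X' ⊗ Y' ⊗ Z')
    simp
  left_unitality X := by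
    let X' : Pres R' := ⟨X.arity⟩
    change (λ_ X').hom = 𝟙 (𝟙_ (Pres R')) ▷ X' ≫ 𝟙 (𝟙_ (Pres R') ⊗ X') ≫ (λ_ X').hom
    simp
  right_unitality X := by
    let X' : Pres R' := ⟨X.arity⟩
    change (ρ_ X').hom = X' ◁ 𝟙 (𝟙_ (Pres R')) ≫ 𝟙 (X' ⊗ 𝟙_ (Pres R')) ≫ (ρ_ X').hom
    simp

/-- The functor `mapFunctor h` is braided. -/
@[reducible] def mapFunctorBraided (h : ∀ ⦃m n : ℕ⦄ (f g : Diag m n), R f g → Cong R' f g) :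
    (mapFunctor h).Braided :=
  { (mapFunctorCore h).toMonoidal with
    braided := fun X Y => by
      let X' : Pres R' := ⟨X.arity⟩
      let Y' : Pres R' := ⟨Y.arity⟩
      change 𝟙 (X' ⊗ Y') ≫ (β_ X' Y').hom = (β_ X' Y').hom ≫ 𝟙 (Y' ⊗ X')
      simp }

/-- Relations that generate the same congruence have equivalent universal categories. -/
def mapEquivalence (h : ∀ ⦃m n : ℕ⦄ (f g : Diag m n), R f g → Cong R' f g)
    (h' : ∀ ⦃m n : ℕ⦄ (f g : Diag m n), R' f g → Cong R f g) : Pres R ≌ Pres R' where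
  functor := mapFunctor h
  inverse := mapFunctor h'
  unitIso := NatIso.ofComponents (fun X => Iso.refl X) (by
    rintro _ _ ⟨f⟩; exact (Category.comp_id _).trans (Category.id_comp _).symm)
  counitIso := NatIso.ofComponents (fun X => Iso.refl X) (by
    rintro _ _ ⟨f⟩; exact (Category.comp_id _).trans (Category.id_comp _).symm)
  functor_unitIso_comp X := by
    change 𝟙 (⟨X.arity⟩ : Pres R') ≫ 𝟙 _ = 𝟙 _
    simp

end Pres

/-- Diagrams identified by the relations `A` are identified by the relations `B`, if these imply
the relations `A`. -/
theorem axRel_le {A B : Set Ax} (h : ∀ a ∈ A, (Pres.genData (axRel B)).Holds a) ⦃m n : ℕ⦄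
    (f g : Diag m n) (e : axRel A f g) : Cong (axRel B) f g := by
  obtain ⟨a, ha, e⟩ := e
  have key : ∀ a, (Pres.genData (axRel B)).Holds a ↔
      Pres.mapHom (R := noRel) (R' := axRel B) (fun _ _ _ _ => False.elim)
        ((Pres.genData noRel).eqn a).lhs =
      Pres.mapHom (fun _ _ _ _ => False.elim) ((Pres.genData noRel).eqn a).rhs := by
    -- Each side of a relation is a class of an explicit diagram, which the comparison map leaves
    -- unchanged by definition.
    intro a; cases a <;> exact Iff.rfl
  have := (key a).mp (h a ha)
  rw [e] at this
  exact Pres.exact this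

theorem mainTheorem2 :
    -- modulo the other axioms, `r8` is equivalent to `q`
    (∀ (C : Type u) [Category.{v} C] [MonoidalCategory C] [BraidedCategory C] (H : C)
      (D : HopfData H), (∀ a ∈ selfdualAxioms, a ≠ .r8 → D.Holds a) →
        (D.Holds .r8 ↔ D.Holds .q)) ∧
    -- modulo the other axioms, `r9` is equivalent to `h10`
    (∀ (C : Type u) [Category.{v} C] [MonoidalCategory C] [BraidedCategory C] (H : C)
      (D : HopfData H), (∀ a ∈ selfdualAxioms, a ≠ .r9 → D.Holds a) →
        (D.Holds .r9 ↔ D.Holds .h10)) ∧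
    -- the two universal categories are equivalent as braided monoidal categories, by an
    -- equivalence that is the identity on objects and on the diagrams in the generators
    (∃ e : UnivCat selfdualAxioms ≌ UnivCat alternativeAxioms,
      Nonempty e.functor.Braided ∧
      (∀ n : ℕ, e.functor.obj ⟨n⟩ = ⟨n⟩) ∧
      ∀ (m n : ℕ) (f : Diag m n),
        e.functor.map (Pres.ofDiag (axRel selfdualAxioms) f) ≍
          Pres.ofDiag (axRel alternativeAxioms) f) := by
  have le : ∀ a ∈ selfdualAxioms, (Pres.genData (axRel alternativeAxioms)).Holds a := by
    have h : (Pres.genData (axRel alternativeAxioms)).Core := fun a ha =>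
      UnivCat.genData_holds _ (by constructor <;> rintro rfl <;> cases ha)
    have h10 : (Pres.genData (axRel alternativeAxioms)).Holds .h10 :=
      UnivCat.genData_holds _ (by constructor <;> nofun)
    intro a ha
    cases a
    case r8 => exact h.holds_r8
    case r9 => exact h.holds_r9_iff.mpr h10
    case q => exact absurd rfl ha.1
    case h10 => exact absurd rfl ha.2
    all_goals exact h _ rfl
  have le' : ∀ a ∈ alternativeAxioms, (Pres.genData (axRel selfdualAxioms)).Holds a := by
    have h : (Pres.genData (axRel selfdualAxioms)).Core := fun a ha =>
      UnivCat.genData_holds _ (by constructor <;> rintro rfl <;> cases ha)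
    have r9 : (Pres.genData (axRel selfdualAxioms)).Holds .r9 :=
      UnivCat.genData_holds _ (by constructor <;> nofun)
    intro a ha
    cases a
    case q => exact h.holds_q
    case h10 => exact h.holds_r9_iff.mp r9
    case r8 => exact absurd rfl ha.1
    case r9 => exact absurd rfl ha.2
    all_goals exact h _ rfl
  refine ⟨fun C _ _ _ H D h => ?_, fun C _ _ _ H D h => ?_,
    Pres.mapEquivalence (axRel_le le) (axRel_le le'), ⟨Pres.mapFunctorBraided _⟩,
    fun _ => rfl, fun _ _ _ => HEq.rfl⟩
  · have hc : D.Core := fun a ha => h a (by constructor <;> rintro rfl <;> cases ha)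
      (by rintro rfl; cases ha)
    exact ⟨fun _ => hc.holds_q, fun _ => hc.holds_r8⟩
  · have hc : D.Core := fun a ha => h a (by constructor <;> rintro rfl <;> cases ha)
      (by rintro rfl; cases ha)
    exact hc.holds_r9_iff
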